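/- Let $Q$ be a CSS code of length $n$, given by finitely many pairwise commuting stabilizer generators $s_{X,1},\dots,s_{X,r_X}\in\{I,X\}^n$ and $s_{Z,1},\dots,s_{Z,r_Z}\in\{I,Z\}^n$, and let $\delta\ge 0$ be an integer such that each generator has weight at most $\delta$ (it acts non-trivially on at most $\delta$ qubits) and each qubit is acted on non-trivially by at most $\delta$ of the generators (of both types together). Then there is a quantum circuit $C$ on the $n$ data qubits and one ancilla qubit per generator, composed of preparations of single qubits in $|0\rangle$ or $|+\rangle$, measurements of single qubits in the $Z$ or $X$ basis, and CNOT gates, with the following properties. 1. $C$ implements the measurement of all the stabilizer generators of $Q$: for every initial state of the qubits, whose restriction to the data qubits is $\rho$, and for every assignment $m$ of one bit $m_g$ to each generator $g$, the circuit returns the outcomes $m$ and leaves the data qubits in the (unnormalized) state $\Pi_m\rho\,\Pi_m$, where $\Pi_m=\prod_g \tfrac12\bigl(I+(-1)^{m_g}g\bigr)$. 2. $C$ has depth $2\delta+2$: it consists of $2\delta+2$ time steps, including those for preparation and measurement, where the operations of one time step act on disjoint sets of qubits, and qubits may be idle. 3. The connectivity graph of $C$, whose vertices are the qubits and in which two qubits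 are adjacent if and only if some CNOT gate of $C$ acts on them, has a $\lceil\delta/2\rceil$-planar layout: the qubits are placed at distinct points of the grid $\mathbb Z^2\subset\mathbb R^2$, the edges are partitioned into $\lceil\delta/2\rceil$ layers, and each edge is drawn as a simple arc in $\mathbb R^2$ that joins the positions of its two end points and avoids all other qubits, such that two arcs of the same layer meet at most in a common end point. Such a layout exists for every placement of the qubits at distinct points of the grid, the placement being the same for all layers. -/

import Mathlib

namespace CSSLayout

noncomputable section

open scoped BigOperators

/-! ### Operators on a finite register of qubits

The computational basis of the qubits labelled by `V` is `V → Fin 2`. -/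

/-- Operators on (and density matrices of) the qubits labelled by `V`. -/
abbrev Operator (V : Type) : Type := Matrix (V → Fin 2) (V → Fin 2) ℂ

/-- The tensor product over the qubits `v` of the one-qubit operators `M v`. -/
def tensor {V : Type} [Fintype V] (M : V → Matrix (Fin 2) (Fin 2) ℂ) : Operator V :=
  Matrix.of fun a b => ∏ v, M v (a v) (b v)

/-- The one-qubit operator `M` acting on the qubit `q`, the identity on all others. -/
def onQubit {V : Type} [Fintype V] [DecidableEq V] (q : V)
    (M : Matrix (Fin 2) (Fin 2) ℂ) : Operator V :=
  tensor fun v => if v = q then M else 1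

/-- The two types of Pauli operators of a CSS code, and the two bases used for the
preparation and the measurement of a qubit. -/
inductive PauliType : Type
  | X
  | Z

/-- The Pauli matrices `X` and `Z`. -/
def PauliType.mat : PauliType → Matrix (Fin 2) (Fin 2) ℂ
  | .X => !![0, 1; 1, 0]
  | .Z => !![1, 0; 0, -1]

/-- The normalized `+1` eigenvector: `|+⟩` for `X`, and `|0⟩` for `Z`. -/
def PauliType.ket : PauliType → (Fin 2 → ℂ)
  | .X => ![((1 / Real.sqrt 2 : ℝ) : ℂ), ((1 / Real.sqrt 2 : ℝ) : ℂ)]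
  | .Z => ![1, 0]

/-- The Pauli operator that is `X` (resp. `Z`) on the qubits of `S`, and the identity
on the others. -/
def pauliString {V : Type} [Fintype V] [DecidableEq V] (p : PauliType) (S : Finset V) :
    Operator V :=
  tensor fun v => if v ∈ S then p.mat else 1

/-- The projector `(1 + (-1)^b P) / 2` onto the `(-1)^b` eigenspace of a Pauli operator `P`. -/
def eigenProj {ι : Type} [DecidableEq ι] (P : Matrix ι ι ℂ) (b : Fin 2) : Matrix ι ι ℂ :=
  (1 / 2 : ℂ) • (1 + (-1 : ℂ) ^ (b : ℕ) • P)

/-- The gate `CNOT` with control `c` and target `t`: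
`|0⟩⟨0|` on `c`, plus `|1⟩⟨1|` on `c` times `X` on `t`. -/
def cnotOp {V : Type} [Fintype V] [DecidableEq V] (c t : V) : Operator V :=
  onQubit c !![1, 0; 0, 0] + onQubit c !![0, 0; 0, 1] * onQubit t PauliType.X.mat

/-- The partial trace over the qubits labelled by `A`. -/
def traceOut {D A : Type} [Fintype A] [DecidableEq A] (ρ : Operator (D ⊕ A)) : Operator D :=
  Matrix.of fun a b => ∑ c : A → Fin 2, ρ (Sum.elim a c) (Sum.elim b c)

/-! ### CSS codes -/

/-- A CSS code of length `n`, given by commuting stabilizer generators: `rX` of them in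
`{I, X}^n` and `rZ` of them in `{I, Z}^n`, each described by the set of qubits on which it acts
non-trivially. (Generators of the same type always commute.) -/
structure CSSCode (n rX rZ : ℕ) : Type where
  suppX : Fin rX → Finset (Fin n)
  suppZ : Fin rZ → Finset (Fin n)
  commute : ∀ i j,
    Commute (pauliString PauliType.X (suppX i)) (pauliString PauliType.Z (suppZ j))

namespace CSSCode

variable {n rX rZ : ℕ}

/-- The set of qubits on which a generator acts non-trivially. -/
def supp (Q : CSSCode n rX rZ) : Fin rX ⊕ Fin rZ → Finset (Fin n) :=
  Sum.elim Q.suppX Q.suppZ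

/-- The weight of a generator. -/
def weight (Q : CSSCode n rX rZ) (g : Fin rX ⊕ Fin rZ) : ℕ := (Q.supp g).card

/-- The number of generators (of both types) that involve the qubit `q`. -/
def qubitDegree (Q : CSSCode n rX rZ) (q : Fin n) : ℕ :=
  (Finset.univ.filter fun g : Fin rX ⊕ Fin rZ => q ∈ Q.supp g).card

/-- The projector onto the joint eigenspace on which each generator `g` has the
eigenvalue `(-1)^(s g)`. All factors commute, so their order is immaterial. -/
def syndromeProj (Q : CSSCode n rX rZ) (s : Fin rX ⊕ Fin rZ → Fin 2) : Operator (Fin n) :=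
  ((List.finRange rX).map fun i =>
      eigenProj (pauliString PauliType.X (Q.suppX i)) (s (Sum.inl i))).prod *
    ((List.finRange rZ).map fun j =>
      eigenProj (pauliString PauliType.Z (Q.suppZ j)) (s (Sum.inr j))).prod

end CSSCode

/-! ### Quantum circuits -/

/-- The elementary operations on qubits labelled by `V` with classical bits labelled by `R`:
preparation of a qubit in `|+⟩` or `|0⟩`, measurement of a qubit in the `X` or `Z` basis with
the outcome written to a classical bit, and `CNOT` gates between two distinct qubits. -/
inductive Op (V R : Type) : Type
  | prep (p : PauliType) (q : V)
  | meas (p : PauliType) (q : V) (r : R)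
  | cnot (c t : V) (h : c ≠ t)

/-- The qubits on which an operation acts. -/
def Op.qubits {V R : Type} : Op V R → Set V
  | .prep _ q => {q}
  | .meas _ q _ => {q}
  | .cnot c t _ => {c, t}

/-- The classical bits to which an operation writes. -/
def Op.bits {V R : Type} : Op V R → Set R
  | .prep _ _ => ∅
  | .meas _ _ r => {r}
  | .cnot _ _ _ => ∅

/-- A joint state of a classical register and a quantum register: to each value `m` of the
classical bits belongs an unnormalized density matrix, whose trace is the probability of `m`. -/
abbrev HybridState (V R : Type) : Type := (R → Fin 2) → Operator V

/-- The action of an elementary operation on joint states. A preparation resets the qubit (with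
Kraus operators `|ψ⟩⟨0|` and `|ψ⟩⟨1|`); a measurement overwrites its classical bit. -/
def Op.apply {V R : Type} [Fintype V] [DecidableEq V] [DecidableEq R] :
    Op V R → HybridState V R → HybridState V R
  | .prep p q, σ => fun m => ∑ j : Fin 2,
      onQubit q (Matrix.vecMulVec p.ket (Pi.single j 1)) * σ m *
        (onQubit q (Matrix.vecMulVec p.ket (Pi.single j 1))).conjTranspose
  | .meas p q r, σ => fun m => ∑ b : Fin 2,
      onQubit q (eigenProj p.mat (m r)) * σ (Function.update m r b) *
        (onQubit q (eigenProj p.mat (m r))).conjTranspose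
  | .cnot c t _, σ => fun m => cnotOp c t * σ m * (cnotOp c t).conjTranspose

/-- A circuit is a sequence of time steps. A time step is a list of operations that are carried
out simultaneously, so they act on disjoint sets of qubits and bits; a qubit may be idle. -/
structure Circuit (V R : Type) : Type where
  steps : List (List (Op V R))
  parallel : ∀ s ∈ steps, s.Pairwise fun o o' =>
    Disjoint o.qubits o'.qubits ∧ Disjoint o.bits o'.bits

namespace Circuit

variable {V R : Type}

/-- The number of time steps, including those of preparation and measurement. -/
def depth (C : Circuit V R) : ℕ := C.steps.length

/-- The joint state after the circuit has run, when the qubits start in the state `ρ`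
and the classical bits start at `0`. -/
def run [Fintype V] [DecidableEq V] [Fintype R] [DecidableEq R] (C : Circuit V R)
    (ρ : Operator V) : HybridState V R :=
  C.steps.foldl (fun σ s => s.foldl (fun τ o => o.apply τ) σ)
    (fun m => if m = 0 then ρ else 0)

/-- The connectivity graph: two qubits are adjacent iff the circuit applies a two-qubit gate
to them. -/
def connectivityGraph (C : Circuit V R) : SimpleGraph V where
  Adj u v := ∃ s ∈ C.steps, ∃ o ∈ s, ∃ (c t : V) (h : c ≠ t),
    o = Op.cnot c t h ∧ ((u = c ∧ v = t) ∨ (u = t ∧ v = c))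
  symm := ⟨by
    rintro u v ⟨s, hs, o, ho, c, t, h, e, huv⟩
    exact ⟨s, hs, o, ho, c, t, h, e, by tauto⟩⟩
  loopless := ⟨by
    rintro u ⟨s, hs, o, ho, c, t, h, e, ⟨h1, h2⟩ | ⟨h1, h2⟩⟩
    · exact h (h1.symm.trans h2)
    · exact h (h2.symm.trans h1)⟩

/-- The circuit, with the data qubits of `Q` and ancilla qubits labelled by `A`, implements the
measurement of all generators of `Q`: whatever the initial state (in particular that of the
ancillas), the circuit returns the syndrome `s` and leaves on the data qubits the state
`Π_s ρ Π_s`, where `ρ` is the initial state of the data qubits and `Π_s` is the projector onto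
the joint eigenspace with syndrome `s`. (Both sides are linear in the initial state, so that the
identity for all matrices is the identity for all density matrices.) -/
def Measures {n rX rZ : ℕ} {A : Type} [Fintype A] [DecidableEq A]
    (C : Circuit (Fin n ⊕ A) (Fin rX ⊕ Fin rZ)) (Q : CSSCode n rX rZ) : Prop :=
  ∀ (ρ : Operator (Fin n ⊕ A)) (s : Fin rX ⊕ Fin rZ → Fin 2),
    traceOut (C.run ρ s) =
      Q.syndromeProj s * traceOut ρ * (Q.syndromeProj s).conjTranspose

end Circuit

/-! ### Layered planar layouts -/

/-- The point of the plane that corresponds to a point of the 2D grid. -/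
def gridPoint (p : ℤ × ℤ) : ℝ × ℝ := ((p.1 : ℝ), (p.2 : ℝ))

/-- An `l`-planar layout of a graph: the vertices are placed at distinct points of the 2D grid,
each edge is assigned to one of `l` layers and drawn as a simple arc between its end points that
avoids all other vertices, and no two edges of the same layer cross or touch, except at a
common end point. -/
structure PlanarLayout {V : Type} (G : SimpleGraph V) (l : ℕ) : Type where
  pos : V ↪ ℤ × ℤ
  layer : G.edgeSet → Fin l
  arc : G.edgeSet → C(unitInterval, ℝ × ℝ)
  arc_injective : ∀ e, Function.Injective (arc e)
  arc_ends : ∀ e : G.edgeSet, ∃ u v : V, (e : Sym2 V) = s(u, v) ∧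
    arc e 0 = gridPoint (pos u) ∧ arc e 1 = gridPoint (pos v)
  arc_avoids : ∀ e, ∀ t ∈ Set.Ioo (0 : unitInterval) 1, ∀ w, arc e t ≠ gridPoint (pos w)
  no_crossing : ∀ e f, e ≠ f → layer e = layer f →
    ∀ t ∈ Set.Ioo (0 : unitInterval) 1, ∀ t' ∈ Set.Ioo (0 : unitInterval) 1,
      arc e t ≠ arc f t'

end

end CSSLayout

/-! The incidence graph between generators and qubits is bipartite of maximum degree at most `δ`, so
by Kőnig's theorem (`exists_bipartite_edgeColoring`) its edges have a proper colouring with `δ`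
colours. The schedule and the layout are both read off from this one colouring.

Schedule: one step of preparations, one step per colour for the couplings of the X ancillas, one per
colour for those of the Z ancillas, one step of measurements. A colour class is a matching, so its
gates can be simultaneous. On a single ancilla, preparation, controlled Pauli operator and readout
amount to the eigenprojector of the generator on the data (`measure_controlled`). Couplings of the
same type commute, so the order imposed by the colours does no harm. Couplings of different types
need not commute, but the full product can still be regrouped ancilla by ancilla, because only
factors on different ancillas have to pass each other (`list_prod_mul_distrib`). That the generators
commute matters only for the order of the resulting projectors.

Layout: putting two colours into each layer gives `⌈δ/2⌉` layers of maximum degree two, that is,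
unions of paths and cycles. The vertices of such a graph can be ordered on a line so that no two
edges interleave (`exists_noncrossing`). Placed in this order on a parabola and joined by chords,
they give a plane drawing, and an injective continuous map of the plane carries the points of the
parabola to the prescribed grid points (`exists_deformation`). The order and the map depend on the
layer, the final positions do not. -/

namespace CSSLayout

/-! ### Noncrossing orders of graphs of maximum degree two -/

/-- No two edges of `G` within `S` interleave in the order given by `t`. -/
def Noncrossing {V : Type} (G : SimpleGraph V) (S : Finset V) (t : V → ℝ) : Prop :=
  ∀ a ∈ S, ∀ b ∈ S, ∀ c ∈ S, ∀ d ∈ S, G.Adj a b → G.Adj c d →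
    ¬(t a < t c ∧ t c < t b ∧ t b < t d)

/-- Each vertex of `S` has at most two neighbours in `S`. -/
def DegreeLeTwoOn {V : Type} (G : SimpleGraph V) (S : Finset V) : Prop :=
  ∀ a ∈ S, ∀ x ∈ S, ∀ y ∈ S, ∀ z ∈ S, G.Adj a x → G.Adj a y → G.Adj a z →
    x = y ∨ y = z ∨ x = z

lemma exists_gt_of_finset {V : Type} (S : Finset V) (t : V → ℝ) (u : V) :
    ∃ r, t u < r ∧ ∀ x ∈ S, t u < t x → r < t x := by
  have h : ∀ᶠ r in nhdsWithin (t u) (Set.Ioi (t u)), ∀ x ∈ S, t u < t x → r < t x := by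
    refine (Finset.eventually_all S).2 fun x _ => ?_
    by_cases hx : t u < t x
    · filter_upwards [nhdsWithin_le_nhds (eventually_lt_nhds hx)] with r hr _ using hr
    · exact Filter.Eventually.of_forall fun r h => absurd h hx
  obtain ⟨r, hr, hr'⟩ := (h.and self_mem_nhdsWithin).exists
  exact ⟨r, hr', hr⟩

lemma exists_lt_of_finset {V : Type} (S : Finset V) (t : V → ℝ) (u : V) :
    ∃ r, r < t u ∧ ∀ x ∈ S, t x < t u → t x < r := by
  obtain ⟨r, h1, h2⟩ := exists_gt_of_finset S (fun v => - t v) u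
  exact ⟨-r, by linarith, fun x hx h => by linarith [h2 x hx (by linarith)]⟩

/-! ### Inserting a vertex into a noncrossing order -/

section Insertion

variable {V : Type} [DecidableEq V]

lemma injOn_update_insert {S : Finset V} {v : V} (hv : v ∉ S) {t : V → ℝ}
    (ht : Set.InjOn t S) {r : ℝ} (hr : ∀ x ∈ S, t x ≠ r) :
    Set.InjOn (Function.update t v r) (insert v S : Finset V) := by
  have hne : ∀ x ∈ S, x ≠ v := fun x hx h => hv (h ▸ hx)
  intro x hx y hy hxy
  simp only [Finset.coe_insert, Set.mem_insert_iff, Finset.mem_coe] at hx hy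
  rcases hx with rfl | hx <;> rcases hy with rfl | hy
  · rfl
  · rw [Function.update_self, Function.update_of_ne (hne y hy)] at hxy
    exact absurd hxy.symm (hr y hy)
  · rw [Function.update_self, Function.update_of_ne (hne x hx)] at hxy
    exact absurd hxy (hr x hx)
  · rw [Function.update_of_ne (hne y hy), Function.update_of_ne (hne x hx)] at hxy
    exact ht hx hy hxy

/-- A vertex placed immediately after its only neighbour has an edge with nothing underneath, which
no other edge can cross. -/
lemma Noncrossing.insert_leaf {G : SimpleGraph V} {S : Finset V} {v : V} (hv : v ∉ S) {t : V → ℝ}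
    (ht : Set.InjOn t S) (hG : Noncrossing G S t) {u : V}
    (huv : ∀ x ∈ S, G.Adj v x → x = u) :
    ∃ t : V → ℝ, Set.InjOn t (insert v S : Finset V) ∧ Noncrossing G (insert v S) t := by
  obtain ⟨r, h1, h2⟩ := exists_gt_of_finset S t u
  have key : ∀ x ∈ S, t x ≤ t u ∨ r < t x := fun x hx => by
    rcases lt_or_ge (t u) (t x) with h | h
    · exact Or.inr (h2 x hx h)
    · exact Or.inl h
  refine ⟨Function.update t v r, injOn_update_insert hv ht fun x hx => ?_, ?_⟩
  · rcases key x hx with h | h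
    · exact (h.trans_lt h1).ne
    · exact h.ne'
  · intro a ha b hb c hc d hd hab hcd
    replace hG := fun ha hb hc hd => hG a ha b hb c hc d hd hab hcd
    rw [Finset.mem_insert] at ha hb hc hd
    by_cases hav : a = v <;> by_cases hbv : b = v <;> by_cases hcv : c = v <;> by_cases hdv : d = v
    all_goals grind [Function.update_apply, G.adj_comm, G.irrefl]

/-- The auxiliary edge `u w` reserves a route free of crossings; `v` is put next to `u`, so that the
edge `v w` follows this route. Only an edge at `u` itself could then be crossed. -/
lemma Noncrossing.insert_subdivision {G : SimpleGraph V} {S : Finset V} {v : V} (hv : v ∉ S)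
    (hdeg : DegreeLeTwoOn G (insert v S)) {u w : V} (hu : u ∈ S) (hw : w ∈ S)
    (hvu : G.Adj v u) (hvw : G.Adj v w) {t : V → ℝ} (huw : t u < t w)
    (ht : Set.InjOn t S) (hG : Noncrossing (G ⊔ SimpleGraph.edge u w) S t) :
    ∃ t : V → ℝ, Set.InjOn t (insert v S : Finset V) ∧ Noncrossing G (insert v S) t := by
  have hne : ∀ x ∈ S, x ≠ v := fun x hx h => hv (h ▸ hx)
  have huw' : u ≠ w := fun h => by simp [h] at huw
  have hGG : ∀ a ∈ S, ∀ b ∈ S, ∀ c ∈ S, ∀ d ∈ S, G.Adj a b → G.Adj c d →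
      ¬(t a < t c ∧ t c < t b ∧ t b < t d) := fun a ha b hb c hc d hd h h' =>
    hG a ha b hb c hc d hd (Or.inl h) (Or.inl h')
  have hGe : ∀ a ∈ S, ∀ b ∈ S, G.Adj a b → ¬(t a < t u ∧ t u < t b ∧ t b < t w) :=
    fun a ha b hb h => hG a ha b hb u hu w hw (Or.inl h)
      (Or.inr (by simp [SimpleGraph.edge_adj, huw']))
  have heG : ∀ a ∈ S, ∀ b ∈ S, G.Adj a b → ¬(t u < t a ∧ t a < t w ∧ t w < t b) :=
    fun a ha b hb h => hG u hu w hw a ha b hb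
      (Or.inr (by simp [SimpleGraph.edge_adj, huw'])) (Or.inl h)
  have hnv : ∀ x ∈ S, G.Adj v x → x = u ∨ x = w := fun x hx h => by
    have := hdeg v (by simp) u (by simp [hu]) w (by simp [hw]) x (by simp [hx]) hvu hvw h
    grind
  clear hG
  -- The side of `u` on which `v` goes: just after `u`, the edge `v w` would cross an edge from `u`
  -- to a point strictly between `u` and `w`. If there is such an edge, it is the only edge at `u`
  -- besides `u v`, and with `v` just before `u` it is nested under `v w`.
  by_cases hb : ∃ b ∈ S, G.Adj u b ∧ t u < t b ∧ t b < t w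
  · obtain ⟨b₀, hb₀, hub₀, h1, h2⟩ := hb
    have hnu : ∀ x ∈ S, G.Adj u x → x = b₀ := fun x hx h => by
      have := hdeg u (by simp [hu]) v (by simp) b₀ (by simp [hb₀]) x (by simp [hx]) hvu.symm hub₀ h
      grind
    clear hdeg
    obtain ⟨r, hr, hr'⟩ := exists_lt_of_finset S t u
    have key : ∀ x ∈ S, t x < r ∨ t u ≤ t x := fun x hx => by
      rcases lt_or_ge (t x) (t u) with h | h
      · exact Or.inl (hr' x hx h)
      · exact Or.inr h
    refine ⟨Function.update t v r, injOn_update_insert hv ht fun x hx => ?_, ?_⟩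
    · rcases key x hx with h | h
      · exact h.ne
      · exact (hr.trans_le h).ne'
    · intro a ha b hb c hc d hd hab hcd
      rw [Finset.mem_insert] at ha hb hc hd
      have inj : ∀ x ∈ S, t x = t u → x = u := fun x hx h => ht hx hu h
      replace hGG := fun ha hb hc hd => hGG a ha b hb c hc d hd hab hcd
      have hab' := hab.symm
      have hcd' := hcd.symm
      clear ht
      by_cases hav : a = v <;> by_cases hbv : b = v <;> by_cases hcv : c = v <;>
        by_cases hdv : d = v
      all_goals simp only [*, Function.update_self, ne_eq, not_false_eq_true,
        Function.update_of_ne, false_or] at *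
      all_goals grind
  · push Not at hb
    clear hdeg
    obtain ⟨r, hr, hr'⟩ := exists_gt_of_finset S t u
    have key : ∀ x ∈ S, t x ≤ t u ∨ r < t x := fun x hx => by
      rcases lt_or_ge (t u) (t x) with h | h
      · exact Or.inr (hr' x hx h)
      · exact Or.inl h
    refine ⟨Function.update t v r, injOn_update_insert hv ht fun x hx => ?_, ?_⟩
    · rcases key x hx with h | h
      · exact (h.trans_lt hr).ne
      · exact h.ne'
    · intro a ha b hb c hc d hd hab hcd
      rw [Finset.mem_insert] at ha hb hc hd
      have inj : ∀ x ∈ S, t x = t u → x = u := fun x hx h => ht hx hu h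
      replace hGG := fun ha hb hc hd => hGG a ha b hb c hc d hd hab hcd
      have hab' := hab.symm
      have hcd' := hcd.symm
      clear ht
      by_cases hav : a = v <;> by_cases hbv : b = v <;> by_cases hcv : c = v <;>
        by_cases hdv : d = v
      all_goals grind [Function.update_apply, G.adj_comm, G.irrefl]

/-- Induction on the vertices. A vertex with two neighbours is suppressed, its neighbours being
joined by an edge; each of them trades its edge to `v` for the new one, so the degree bound
survives. -/
theorem exists_noncrossing (S : Finset V) (G : SimpleGraph V) (hG : DegreeLeTwoOn G S) :
    ∃ t : V → ℝ, Set.InjOn t S ∧ Noncrossing G S t := by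
  induction S using Finset.induction_on generalizing G with
  | empty => exact ⟨0, by simp, by simp [Noncrossing]⟩
  | insert v S hv ih =>
    have hsub : DegreeLeTwoOn G S := fun a ha x hx y hy z hz =>
      hG a (Finset.mem_insert_of_mem ha) x (Finset.mem_insert_of_mem hx)
        y (Finset.mem_insert_of_mem hy) z (Finset.mem_insert_of_mem hz)
    by_cases h : ∃ u ∈ S, ∃ w ∈ S, u ≠ w ∧ G.Adj v u ∧ G.Adj v w
    · obtain ⟨u, hu, w, hw, huw, hvu, hvw⟩ := h
      have hdeg : DegreeLeTwoOn (G ⊔ SimpleGraph.edge u w) S := by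
        intro a ha x hx y hy z hz
        simp only [SimpleGraph.sup_adj, SimpleGraph.edge_adj]
        have h1 := hG u (by simp [hu]) v (by simp)
        have h2 := hG w (by simp [hw]) v (by simp)
        have h3 := hsub a ha x hx y hy z hz
        grind [G.adj_comm]
      obtain ⟨t, ht, htG⟩ := ih _ hdeg
      rcases lt_or_gt_of_ne fun h => huw (ht hu hw h) with hlt | hlt
      · exact htG.insert_subdivision hv hG hu hw hvu hvw hlt ht
      · rw [SimpleGraph.edge_comm] at htG
        exact htG.insert_subdivision hv hG hw hu hvw hvu hlt ht
    · obtain ⟨t, ht, htG⟩ := ih G hsub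
      by_cases h' : ∃ u ∈ S, G.Adj v u
      · obtain ⟨u, hu, hvu⟩ := h'
        exact htG.insert_leaf hv ht (u := u) fun x hx hvx => by grind
      -- Without neighbours any anchor will do; the old value of `t` at `v` serves.
      · exact htG.insert_leaf hv ht (u := v) fun x hx hvx => by grind

end Insertion

/-! ### Drawing graphs of maximum degree two at prescribed positions -/

/-- An interpolating continuous function through finitely many points. -/
lemma exists_continuous_interpolation {V : Type} [Finite V] (a b : V → ℝ)
    (ha : Function.Injective a) : ∃ f : ℝ → ℝ, Continuous f ∧ ∀ v, f (a v) = b v := by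
  classical
  have := Fintype.ofFinite V
  exact ⟨fun x => (Lagrange.interpolate Finset.univ a b).eval x, Polynomial.continuous _,
    fun v => Lagrange.eval_interpolate_at_node b ha.injOn (Finset.mem_univ v)⟩

/-- Irrationality of `√2` yields a linear coordinate that separates all grid points, as required for
interpolation along it. -/
lemma sqrt_two_shear_injective :
    Function.Injective fun p : ℤ × ℤ => (p.1 : ℝ) + Real.sqrt 2 * (p.2 : ℝ) := by
  rintro ⟨a, b⟩ ⟨c, d⟩ h
  simp only at h
  by_cases hbd : b = d
  · subst hbd
    have : (a : ℝ) = c := by linarith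
    simpa using this
  · exfalso
    have hne : ((b - d : ℤ) : ℝ) ≠ 0 := by exact_mod_cast sub_ne_zero.2 hbd
    refine irrational_sqrt_two ⟨((c - a : ℤ) : ℚ) / ((b - d : ℤ) : ℚ), ?_⟩
    push_cast at hne ⊢
    rw [div_eq_iff hne]
    linarith

/-- The plane can be deformed so that distinct points of the parabola `x = y ^ 2` move to
prescribed distinct points of the grid. -/
lemma exists_deformation {V : Type} [Finite V] (t : V → ℝ) (ht : Function.Injective t)
    (pos : V ↪ ℤ × ℤ) : ∃ Φ : ℝ × ℝ → ℝ × ℝ, Continuous Φ ∧ Function.Injective Φ ∧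
      ∀ v, Φ (t v ^ 2, t v) = gridPoint (pos v) := by
  set α : V → ℝ := fun v => ((pos v).1 : ℝ) + Real.sqrt 2 * ((pos v).2 : ℝ) with hα
  have hαi : Function.Injective α := sqrt_two_shear_injective.comp pos.injective
  obtain ⟨g, hg, hg'⟩ := exists_continuous_interpolation t (fun v => α v - t v ^ 2) ht
  obtain ⟨h, hh, hh'⟩ := exists_continuous_interpolation α (fun v => ((pos v).2 : ℝ) - t v) hαi
  -- A horizontal shear by `g` moves each point to the abscissa `α v`; these are distinct, so a
  -- vertical shear by `h` can then set the ordinates; a linear map finally removes the term with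
  -- `√2`. Each of the three maps is injective.
  refine ⟨fun p => (p.1 + g p.2 - Real.sqrt 2 * (p.2 + h (p.1 + g p.2)),
    p.2 + h (p.1 + g p.2)), by fun_prop, ?_, ?_⟩
  · rintro ⟨x, y⟩ ⟨x', y'⟩ hxy
    simp only [Prod.mk.injEq] at hxy
    obtain ⟨h1, h2⟩ := hxy
    rw [h2] at h1
    have h3 : x + g y = x' + g y' := by linarith
    rw [h3] at h2
    have h4 : y = y' := by linarith
    subst h4
    simpa using h3
  · intro v
    have e : t v ^ 2 + g (t v) = α v := by rw [hg']; ring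
    simp only [e, hh', gridPoint, Prod.mk.injEq]
    exact ⟨by simp only [hα]; ring, by ring⟩

/-- The point at time `s` on the chord of the parabola `x = y ^ 2` from height `a` to `b`. -/
def chord (a b s : ℝ) : ℝ × ℝ :=
  ((1 - s) * a ^ 2 + s * b ^ 2, (1 - s) * a + s * b)

lemma continuous_chord (a b : ℝ) : Continuous (chord a b) := by
  unfold chord; fun_prop

lemma chord_injective {a b : ℝ} (hab : a ≠ b) : Function.Injective (chord a b) := by
  intro s s' h
  have h2 : (1 - s) * a + s * b = (1 - s') * a + s' * b := congrArg Prod.snd h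
  have : (s - s') * (b - a) = 0 := by linarith
  rcases mul_eq_zero.1 this with h | h
  · linarith
  · exact absurd (by linarith) hab

/-- The excess over the parabola at height `y` is `(y - a) * (b - y)`, so whether chords meet
becomes a comparison of such products. -/
lemma chord_fst (a b s : ℝ) :
    (chord a b s).1 = (chord a b s).2 ^ 2 + ((chord a b s).2 - a) * (b - (chord a b s).2) := by
  simp only [chord]; ring

lemma chord_snd_mem {a b s : ℝ} (hab : a < b) (hs : s ∈ Set.Ioo (0 : ℝ) 1) :
    a < (chord a b s).2 ∧ (chord a b s).2 < b := by
  obtain ⟨h0, h1⟩ := hs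
  simp only [chord]
  constructor <;> nlinarith

lemma chord_ne_parabola {a b s : ℝ} (hab : a < b) (hs : s ∈ Set.Ioo (0 : ℝ) 1) (r : ℝ) :
    chord a b s ≠ (r ^ 2, r) := by
  intro h
  have h1 := chord_fst a b s
  obtain ⟨h2, h3⟩ := chord_snd_mem hab hs
  rw [h] at h1 h2 h3
  simp only at h1 h2 h3
  nlinarith [mul_pos (sub_pos.2 h2) (sub_pos.2 h3)]

/-- Chords over disjoint intervals share no height; for nested distinct intervals the excess over
the parabola is strictly larger on the outer one; interleaving is excluded by hypothesis. -/
lemma chord_ne_chord {a b c d s s' : ℝ} (hab : a < b) (hcd : c < d) (hs : s ∈ Set.Ioo (0 : ℝ) 1)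
    (hs' : s' ∈ Set.Ioo (0 : ℝ) 1) (h1 : ¬(a < c ∧ c < b ∧ b < d))
    (h2 : ¬(c < a ∧ a < d ∧ d < b)) (hne : ¬(a = c ∧ b = d)) :
    chord a b s ≠ chord c d s' := by
  -- The nested case: the difference of the two products is a sum of two nonnegative terms, hence
  -- both vanish.
  have main : ∀ a b c d y : ℝ, a < y → y < b → c < y → y < d → a ≤ c → d ≤ b →
      (y - a) * (b - y) = (y - c) * (d - y) → a = c ∧ b = d := by
    intro a b c d y h1 h2 h3 h4 h5 h6 h7
    have : (c - a) * (b - y) + (y - c) * (b - d) = 0 := by linarith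
    have e1 : 0 ≤ (c - a) * (b - y) := mul_nonneg (by linarith) (by linarith)
    have e2 : 0 ≤ (y - c) * (b - d) := mul_nonneg (by linarith) (by linarith)
    have e3 : (c - a) * (b - y) = 0 := by linarith
    have e4 : (y - c) * (b - d) = 0 := by linarith
    rcases mul_eq_zero.1 e3 with e | e <;> rcases mul_eq_zero.1 e4 with e' | e' <;>
      constructor <;> linarith
  intro h
  obtain ⟨p1, p2⟩ := chord_snd_mem hab hs
  obtain ⟨p3, p4⟩ := chord_snd_mem hcd hs'
  have q1 := chord_fst a b s
  have q2 := chord_fst c d s'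
  rw [h] at p1 p2 q1
  set y := (chord c d s').2
  have q : (y - a) * (b - y) = (y - c) * (d - y) := by linarith
  rcases le_total a c with hac | hac <;> rcases le_total d b with hdb | hdb
  · exact hne (main a b c d y p1 p2 p3 p4 hac hdb q)
  · rcases hac.eq_or_lt with e | e
    · obtain ⟨e1, e2⟩ := main c d a b y p3 p4 p1 p2 e.ge hdb q.symm
      exact hne ⟨e1.symm, e2.symm⟩
    · rcases hdb.eq_or_lt with e' | e'
      · exact hne (main a b c d y p1 p2 p3 p4 hac e'.ge q)
      · exact h1 ⟨e, by linarith, e'⟩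
  · rcases hac.eq_or_lt with e | e
    · exact hne (main a b c d y p1 p2 p3 p4 e.ge hdb q)
    · rcases hdb.eq_or_lt with e' | e'
      · obtain ⟨e1, e2⟩ := main c d a b y p3 p4 p1 p2 hac e'.ge q.symm
        exact hne ⟨e1.symm, e2.symm⟩
      · exact h2 ⟨e, by linarith, e'⟩
  · obtain ⟨e1, e2⟩ := main c d a b y p3 p4 p1 p2 hac hdb q.symm
    exact hne ⟨e1.symm, e2.symm⟩

/-- If each vertex lies on at most two edges of each layer, the graph has a layered planar layout
with these layers and arbitrary vertex positions. -/
theorem exists_planarLayout {V : Type} [Fintype V] (G : SimpleGraph V) {l : ℕ}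
    (layer : G.edgeSet → Fin l)
    (hlayer : ∀ (k : Fin l) (v x y z : V) (hx : G.Adj v x) (hy : G.Adj v y) (hz : G.Adj v z),
      layer ⟨s(v, x), hx⟩ = k → layer ⟨s(v, y), hy⟩ = k → layer ⟨s(v, z), hz⟩ = k →
        x = y ∨ y = z ∨ x = z)
    (pos : V ↪ ℤ × ℤ) : ∃ L : PlanarLayout G l, L.pos = pos := by
  classical
  let H : Fin l → SimpleGraph V := fun k =>
    { Adj := fun u v => ∃ h : G.Adj u v, layer ⟨s(u, v), h⟩ = k
      symm := ⟨by
        rintro u v ⟨h, e⟩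
        refine ⟨h.symm, ?_⟩
        rw [← e]
        congr 2
        exact Sym2.eq_swap⟩
      loopless := ⟨fun u ⟨h, _⟩ => G.irrefl h⟩ }
  have hH : ∀ k, ∃ t : V → ℝ, Function.Injective t ∧ Noncrossing (H k) Finset.univ t := by
    intro k
    obtain ⟨t, h1, h2⟩ := exists_noncrossing Finset.univ (H k) (by
      rintro v - x - y - z - ⟨hx, ex⟩ ⟨hy, ey⟩ ⟨hz, ez⟩
      exact hlayer k v x y z hx hy hz ex ey ez)
    exact ⟨t, by simpa [Set.injOn_univ] using h1, h2⟩
  choose t ht hnc using hH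
  -- Every layer has its own order and its own deformation; the deformations agree in sending each
  -- vertex to `pos`.
  choose Φ hΦc hΦi hΦ using fun k => exists_deformation (t k) (ht k) pos
  have hends : ∀ e : G.edgeSet, ∃ p : V × V, (e : Sym2 V) = s(p.1, p.2) ∧
      t (layer e) p.1 < t (layer e) p.2 := by
    rintro ⟨e, he⟩
    induction e using Sym2.ind with
    | _ u v =>
      have hne : u ≠ v := G.ne_of_adj he
      rcases lt_or_gt_of_ne fun h => hne (ht (layer ⟨s(u, v), he⟩) h) with h | h
      · exact ⟨(u, v), rfl, h⟩
      · exact ⟨(v, u), Sym2.eq_swap, h⟩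
  choose p hp hlt using hends
  have hadj : ∀ e, (H (layer e)).Adj (p e).1 (p e).2 := by
    intro e
    have h : G.Adj (p e).1 (p e).2 := by
      have := e.2
      rwa [hp e] at this
    refine ⟨h, ?_⟩
    congr 1
    exact Subtype.ext (hp e).symm
  have coe_mem : ∀ s ∈ Set.Ioo (0 : unitInterval) 1, (s : ℝ) ∈ Set.Ioo (0 : ℝ) 1 := fun s hs => hs
  refine ⟨
    { pos := pos
      layer := layer
      arc := fun e => ⟨fun s => Φ (layer e) (chord (t (layer e) (p e).1) (t (layer e) (p e).2) s),
        (hΦc _).comp ((continuous_chord _ _).comp continuous_subtype_val)⟩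
      arc_injective := fun e => (hΦi _).comp
        ((chord_injective (hlt e).ne).comp Subtype.val_injective)
      arc_ends := fun e => ⟨(p e).1, (p e).2, hp e, ?_, ?_⟩
      arc_avoids := ?_
      no_crossing := ?_ }, rfl⟩
  · rw [← hΦ (layer e)]
    simp [chord]
  · rw [← hΦ (layer e)]
    simp [chord]
  · intro e s hs w h
    rw [← hΦ (layer e)] at h
    exact chord_ne_parabola (hlt e) (coe_mem s hs) _ (hΦi _ h)
  · intro e f hef hl s hs s' hs' h
    simp only [ContinuousMap.coe_mk] at h
    have hf := hadj f
    have hltf := hlt f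
    rw [← hl] at h hf hltf
    have hn := hnc (layer e)
    refine chord_ne_chord (hlt e) hltf (coe_mem s hs) (coe_mem s' hs') ?_ ?_ ?_ (hΦi _ h)
    · exact hn _ (by simp) _ (by simp) _ (by simp) _ (by simp) (hadj e) hf
    · exact hn _ (by simp) _ (by simp) _ (by simp) _ (by simp) hf (hadj e)
    · rintro ⟨h1, h2⟩
      exact hef (Subtype.ext (by rw [hp e, hp f, ht _ h1, ht _ h2]))

/-! ### Edge colourings of bipartite graphs -/

/-- A matrix of natural numbers with constant positive row and column sums contains
a permutation matrix. -/
lemma exists_perm_pos {ι : Type} [Fintype ι] (M : ι → ι → ℕ) (k : ℕ)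
    (hr : ∀ i, ∑ j, M i j = k + 1) (hc : ∀ j, ∑ i, M i j = k + 1) :
    ∃ σ : Equiv.Perm ι, ∀ i, 0 < M i (σ i) := by
  classical
  have hk : (0 : ℚ) < k + 1 := by positivity
  -- After scaling, Birkhoff's theorem writes the matrix as a convex combination of permutation
  -- matrices; any permutation of positive weight has only positive entries of `M` along it.
  let N : Matrix ι ι ℚ := Matrix.of fun i j => (M i j : ℚ) / (k + 1)
  have hN : N ∈ doublyStochastic ℚ ι := by
    rw [mem_doublyStochastic_iff_sum]
    refine ⟨fun i j => by simp only [N, Matrix.of_apply]; positivity, fun i => ?_, fun j => ?_⟩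
    · simp only [N, Matrix.of_apply]
      rw [← Finset.sum_div, div_eq_one_iff_eq hk.ne']
      exact_mod_cast hr i
    · simp only [N, Matrix.of_apply]
      rw [← Finset.sum_div, div_eq_one_iff_eq hk.ne']
      exact_mod_cast hc j
  obtain ⟨w, hw0, hw1, hw⟩ := exists_eq_sum_perm_of_mem_doublyStochastic hN
  obtain ⟨σ, -, hσ⟩ : ∃ σ ∈ Finset.univ, 0 < w σ := by
    by_contra! h
    have := Finset.sum_nonpos h
    rw [hw1] at this
    linarith
  refine ⟨σ, fun i => Nat.pos_of_ne_zero fun h0 => ?_⟩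
  have h1 : N i (σ i) = 0 := by simp [N, h0]
  rw [← hw, Matrix.sum_apply] at h1
  have h2 := (Finset.sum_eq_zero_iff_of_nonneg fun τ _ => by
    rw [Matrix.smul_apply, Equiv.Perm.permMatrix, PEquiv.toMatrix_apply]
    split_ifs <;> simp [hw0 τ]).1 h1 σ (Finset.mem_univ _)
  simp [Equiv.Perm.permMatrix, PEquiv.toMatrix_apply] at h2
  exact hσ.ne' h2

/-- A matrix of natural numbers with all row and column sums equal to `k` is covered by
`k` permutation matrices. -/
lemma exists_perms_cover {ι : Type} [Fintype ι] (k : ℕ) (M : ι → ι → ℕ)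
    (hr : ∀ i, ∑ j, M i j = k) (hc : ∀ j, ∑ i, M i j = k) :
    ∃ σ : ℕ → Equiv.Perm ι, ∀ i j, 0 < M i j → ∃ c < k, σ c i = j := by
  classical
  induction k generalizing M with
  | zero =>
    refine ⟨fun _ => 1, fun i j h => ?_⟩
    have := (Finset.sum_eq_zero_iff.1 (hr i)) j (Finset.mem_univ _)
    omega
  | succ k ih =>
    obtain ⟨τ, hτ⟩ := exists_perm_pos M k hr hc
    -- The subtraction never truncates, since `M` is positive along `τ`; all row and column sums
    -- drop by one.
    let M' : ι → ι → ℕ := fun i j => M i j - if τ i = j then 1 else 0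
    have hM' : ∀ i j, M' i j + (if τ i = j then 1 else 0) = M i j := by
      intro i j
      by_cases h : τ i = j
      · have := hτ i
        rw [h] at this
        simp only [M', h, if_true]
        omega
      · simp [M', h]
    obtain ⟨σ, hσ⟩ := ih M'
      (fun i => by
        have := hr i
        simp only [← hM', Finset.sum_add_distrib, Finset.sum_ite_eq, Finset.mem_univ,
          if_true] at this
        omega)
      (fun j => by
        have := hc j
        simp only [← hM', Finset.sum_add_distrib, ← Equiv.eq_symm_apply, Finset.sum_ite_eq',
          Finset.mem_univ, if_true] at this
        omega)
    refine ⟨Function.update σ k τ, fun i j h => ?_⟩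
    by_cases hij : τ i = j
    · exact ⟨k, by omega, by simpa using hij⟩
    · obtain ⟨c, hc, e⟩ := hσ i j (by simpa [M', hij] using h)
      exact ⟨c, by omega, by rwa [Function.update_of_ne hc.ne]⟩

/-- **Kőnig's line colouring theorem**: the edges of a bipartite graph of maximum degree at
most `k` can be coloured with `k` colours. -/
theorem exists_bipartite_edgeColoring {α β : Type} [Fintype α] [Fintype β] [DecidableEq β]
    (S : α → Finset β) (k : ℕ) (hα : ∀ a, (S a).card ≤ k)
    (hβ : ∀ b, (Finset.univ.filter fun a => b ∈ S a).card ≤ k) :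
    ∃ c : α → β → ℕ, (∀ a, ∀ b ∈ S a, c a b < k) ∧
      (∀ a, ∀ b ∈ S a, ∀ b' ∈ S a, c a b = c a b' → b = b') ∧
      ∀ a a' b, b ∈ S a → b ∈ S a' → c a b = c a' b → a = a' := by
  classical
  let A : α → β → ℕ := fun a b => if b ∈ S a then 1 else 0
  have hrow : ∀ a, ∑ b, A a b = (S a).card := fun a => by simp [A]
  have hcol : ∀ b, ∑ a, A a b = (Finset.univ.filter fun a => b ∈ S a).card := fun b => by
    simp [A]
  -- The incidence matrix and its transpose form the off-diagonal blocks, and diagonal entries make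
  -- up the missing degrees, so that every row and column sums to `k`. Each permutation of a cover
  -- then serves as one colour: being a function separates edges at `a`, being injective separates
  -- edges at `b`.
  let M : α ⊕ β → α ⊕ β → ℕ := fun x y => match x, y with
    | .inl a, .inr b => A a b
    | .inl a, .inl a' => if a = a' then k - ∑ b, A a b else 0
    | .inr b, .inr b' => if b = b' then k - ∑ a, A a b else 0
    | .inr b, .inl a => A a b
  obtain ⟨σ, hσ⟩ := exists_perms_cover k M
    (by
      rintro (a | b)
      · have := hα a
        simp only [M, Fintype.sum_sum_type, Finset.sum_ite_eq, Finset.mem_univ, if_true, hrow]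
        omega
      · have := hβ b
        simp only [M, Fintype.sum_sum_type, Finset.sum_ite_eq, Finset.mem_univ, if_true, hcol]
        omega)
    (by
      rintro (a | b)
      · have := hα a
        simp only [M, Fintype.sum_sum_type, Finset.sum_ite_eq', Finset.mem_univ, if_true, hrow]
        omega
      · have := hβ b
        simp only [M, Fintype.sum_sum_type, Finset.sum_ite_eq', Finset.mem_univ, if_true, hcol]
        omega)
  have hc : ∀ a b, ∃ c, b ∈ S a → c < k ∧ σ c (.inl a) = .inr b := by
    intro a b
    by_cases h : b ∈ S a
    · obtain ⟨c, h1, h2⟩ := hσ (.inl a) (.inr b) (by simp [M, A, h])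
      exact ⟨c, fun _ => ⟨h1, h2⟩⟩
    · exact ⟨0, fun h' => absurd h' h⟩
  choose c hc using hc
  refine ⟨c, fun a b h => (hc a b h).1, fun a b h b' h' e => ?_, fun a a' b h h' e => ?_⟩
  · have h1 := (hc a b h).2
    rw [e, (hc a b' h').2] at h1
    exact (Sum.inr_injective h1).symm
  · have h1 := (hc a b h).2
    rw [← (hc a' b h').2, e] at h1
    exact Sum.inl_injective ((σ _).injective h1)

/-! ### Tensor products of operators on data qubits and on single ancillas -/

set_option linter.unusedSectionVars false

section Tensor

variable {V : Type} [Fintype V] [DecidableEq V]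

lemma tensor_mul (M N : V → Matrix (Fin 2) (Fin 2) ℂ) :
    tensor M * tensor N = tensor fun v => M v * N v := by
  ext a b
  simp only [tensor, Matrix.mul_apply, Matrix.of_apply, Finset.prod_univ_sum,
    Fintype.piFinset_univ, Finset.prod_mul_distrib]

lemma tensor_one : tensor (fun _ : V => (1 : Matrix (Fin 2) (Fin 2) ℂ)) = 1 := by
  ext a b
  simp only [tensor, Matrix.of_apply, Matrix.one_apply, Finset.prod_ite_zero, Finset.prod_const_one,
    Finset.mem_univ, true_imp_iff, funext_iff]

lemma onQubit_mul (q : V) (M N : Matrix (Fin 2) (Fin 2) ℂ) :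
    onQubit q M * onQubit q N = onQubit q (M * N) := by
  rw [onQubit, onQubit, tensor_mul, onQubit]
  congr 1
  ext1 v
  split_ifs <;> simp

lemma onQubit_one (q : V) : onQubit q 1 = 1 := by
  simp [onQubit, tensor_one]

lemma onQubit_eq_update (q : V) (M : Matrix (Fin 2) (Fin 2) ℂ) (a b : V → Fin 2) :
    onQubit q M a b = M (a q) (b q) * ∏ v ∈ Finset.univ.erase q, (1 : Matrix _ _ ℂ) (a v) (b v) := by
  rw [onQubit, tensor, Matrix.of_apply, ← Finset.mul_prod_erase _ _ (Finset.mem_univ q)]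
  congr 1
  · simp
  · refine Finset.prod_congr rfl fun v hv => ?_
    rw [if_neg (Finset.ne_of_mem_erase hv)]

lemma onQubit_add (q : V) (M N : Matrix (Fin 2) (Fin 2) ℂ) :
    onQubit q (M + N) = onQubit q M + onQubit q N := by
  ext a b
  simp only [Matrix.add_apply, onQubit_eq_update, add_mul]

lemma onQubit_smul (q : V) (c : ℂ) (M : Matrix (Fin 2) (Fin 2) ℂ) :
    onQubit q (c • M) = c • onQubit q M := by
  ext a b
  simp only [Matrix.smul_apply, onQubit_eq_update, smul_eq_mul, mul_assoc]

lemma onQubit_zero (q : V) : onQubit q (0 : Matrix (Fin 2) (Fin 2) ℂ) = 0 := by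
  simpa using onQubit_smul q 0 (0 : Matrix (Fin 2) (Fin 2) ℂ)

lemma onQubit_eigenProj (q : V) (P : Matrix (Fin 2) (Fin 2) ℂ) (b : Fin 2) :
    onQubit q (eigenProj P b) = eigenProj (onQubit q P) b := by
  rw [eigenProj, onQubit_smul, onQubit_add, onQubit_smul, onQubit_one, eigenProj]

lemma commute_tensor {M N : V → Matrix (Fin 2) (Fin 2) ℂ} (h : ∀ v, Commute (M v) (N v)) :
    Commute (tensor M) (tensor N) := by
  rw [Commute, SemiconjBy, tensor_mul, tensor_mul]
  simp only [(h _).eq]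

lemma commute_onQubit {q q' : V} (h : q ≠ q') (M N : Matrix (Fin 2) (Fin 2) ℂ) :
    Commute (onQubit q M) (onQubit q' N) := by
  refine commute_tensor fun v => ?_
  split_ifs with h1 h2
  · exact absurd (h1.symm.trans h2) h
  all_goals simp

lemma commute_onQubit_pauliString {q : V} {S : Finset V} (h : q ∉ S)
    (M : Matrix (Fin 2) (Fin 2) ℂ) (p : PauliType) :
    Commute (onQubit q M) (pauliString p S) := by
  refine commute_tensor fun v => ?_
  split_ifs with h1 h2
  · exact absurd (h1 ▸ h2) h
  all_goals simp

lemma commute_pauliString (p : PauliType) (S T : Finset V) :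
    Commute (pauliString p S) (pauliString p T) := by
  refine commute_tensor fun v => ?_
  split_ifs <;> simp

lemma pauliString_empty (p : PauliType) : pauliString p (∅ : Finset V) = 1 := by
  simp [pauliString, tensor_one]

lemma pauliString_cons (p : PauliType) {q : V} {S : Finset V} (h : q ∉ S) :
    onQubit q p.mat * pauliString p S = pauliString p (insert q S) := by
  rw [onQubit, pauliString, tensor_mul, pauliString]
  congr 1
  ext1 v
  by_cases h1 : v = q
  · subst h1; simp [h]
  · simp [h1]

end Tensor

section EigenProj

variable {ι : Type} [Fintype ι] [DecidableEq ι]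

lemma commute_eigenProj_right {A P : Matrix ι ι ℂ} (h : Commute A P) (b : Fin 2) :
    Commute A (eigenProj P b) :=
  ((Commute.one_right A).add_right (h.smul_right _)).smul_right _

lemma commute_eigenProj {P P' : Matrix ι ι ℂ} (h : Commute P P') (b b' : Fin 2) :
    Commute (eigenProj P b) (eigenProj P' b') :=
  commute_eigenProj_right (commute_eigenProj_right h.symm b).symm b'

end EigenProj

/-! ### Operators that factor into a data part and single-ancilla parts -/

section Ext

variable {D A : Type} [Fintype D] [DecidableEq D] [Fintype A] [DecidableEq A]

/-- The operator `R` on the data qubits, tensored with the operators `N a` on the ancillas. -/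
def extend (R : Operator D) (N : A → Matrix (Fin 2) (Fin 2) ℂ) : Operator (D ⊕ A) :=
  Matrix.of fun x y => R (x ∘ Sum.inl) (y ∘ Sum.inl) * ∏ a, N a (x (.inr a)) (y (.inr a))

lemma tensor_eq_extend (M : D ⊕ A → Matrix (Fin 2) (Fin 2) ℂ) :
    tensor M = extend (tensor fun d => M (.inl d)) fun a => M (.inr a) := by
  ext x y
  simp [tensor, extend, Fintype.prod_sum_type]

lemma extend_mul (R R' : Operator D) (N N' : A → Matrix (Fin 2) (Fin 2) ℂ) :
    extend R N * extend R' N' = extend (R * R') fun a => N a * N' a := by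
  ext x y
  simp only [extend, Matrix.mul_apply, Matrix.of_apply, Finset.prod_univ_sum,
    Fintype.piFinset_univ, Finset.prod_mul_distrib]
  rw [Finset.sum_mul_sum, ← Fintype.sum_prod_type',
    ← (Equiv.sumArrowEquivProdArrow D A (Fin 2)).sum_comp]
  refine Finset.sum_congr rfl fun z _ => ?_
  simp only [Equiv.sumArrowEquivProdArrow, Equiv.coe_fn_mk, Function.comp_def]
  ring

lemma extend_conjTranspose (R : Operator D) (N : A → Matrix (Fin 2) (Fin 2) ℂ) :
    (extend R N).conjTranspose = extend R.conjTranspose fun a => (N a).conjTranspose := by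
  ext x y
  simp [extend, Matrix.conjTranspose_apply]

lemma extend_smul_left (c : ℂ) (R : Operator D) (N : A → Matrix (Fin 2) (Fin 2) ℂ) :
    extend (c • R) N = c • extend R N := by
  ext x y
  simp [extend, mul_assoc]

lemma extend_add_left (R R' : Operator D) (N : A → Matrix (Fin 2) (Fin 2) ℂ) :
    extend (R + R') N = extend R N + extend R' N := by
  ext x y
  simp [extend, add_mul]

lemma extend_smul_right (c : A → ℂ) (R : Operator D) (N : A → Matrix (Fin 2) (Fin 2) ℂ) :
    extend R (fun a => c a • N a) = (∏ a, c a) • extend R N := by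
  ext x y
  simp [extend, Finset.prod_mul_distrib, mul_left_comm]

lemma extend_one : extend (1 : Operator D) (fun _ : A => 1) = 1 := by
  rw [← tensor_one, ← tensor_one, tensor_eq_extend]

lemma traceOut_extend (R : Operator D) (N : A → Matrix (Fin 2) (Fin 2) ℂ) :
    traceOut (extend R N) = (∏ a, (N a).trace) • R := by
  ext x y
  simp only [traceOut, extend, Matrix.of_apply, Matrix.smul_apply, Matrix.trace, Matrix.diag,
    Finset.prod_univ_sum, Fintype.piFinset_univ, smul_eq_mul, Sum.elim_comp_inl, Sum.elim_inr]
  rw [← Finset.mul_sum, mul_comm]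

lemma onQubit_inr (a : A) (M : Matrix (Fin 2) (Fin 2) ℂ) :
    onQubit (V := D ⊕ A) (.inr a) M = extend 1 (Function.update 1 a M) := by
  rw [onQubit, tensor_eq_extend]
  simp only [reduceCtorEq, if_false, tensor_one, Sum.inr.injEq]
  congr 1
  ext1 a'
  by_cases h : a' = a
  · subst h; simp
  · simp [h]

lemma pauliString_map_inl (p : PauliType) (S : Finset D) :
    pauliString p (S.map ⟨Sum.inl, Sum.inl_injective⟩ : Finset (D ⊕ A)) =
      extend (pauliString p S) fun _ => 1 := by
  rw [pauliString, tensor_eq_extend]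
  simp [pauliString]

/-- Matrix units are product operators, so a linear identity need only be checked on products. -/
lemma single_eq_extend (x y : D ⊕ A → Fin 2) :
    Matrix.single x y (1 : ℂ) =
      extend (Matrix.single (x ∘ Sum.inl) (y ∘ Sum.inl) 1)
        fun a => Matrix.single (x (.inr a)) (y (.inr a)) 1 := by
  ext x' y'
  simp only [extend, Matrix.of_apply, Matrix.single_apply, Finset.prod_ite_zero,
    Finset.prod_const_one, Finset.mem_univ, true_imp_iff, ← ite_and, mul_ite, mul_one, mul_zero]
  congr 1
  simp only [funext_iff, Sum.forall, Function.comp_apply, eq_iff_iff, forall_and]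
  tauto

end Ext

/-! ### Controlled Pauli operators -/

/-- The other type of Pauli operators. -/
def PauliType.dual : PauliType → PauliType
  | .X => .Z
  | .Z => .X

/-! ### Identities for a single ancilla -/

section OneQubit

lemma eigenProj_mul_self (p : PauliType) (b : Fin 2) :
    eigenProj p.mat b * eigenProj p.mat b = eigenProj p.mat b := by
  cases p <;> fin_cases b <;> ext i j <;> fin_cases i <;> fin_cases j <;>
    norm_num [eigenProj, PauliType.mat, Matrix.mul_apply, Matrix.one_apply]

lemma eigenProj_zero_mul_one (p : PauliType) :
    eigenProj p.mat 0 * eigenProj p.mat 1 = 0 := by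
  cases p <;> ext i j <;> fin_cases i <;> fin_cases j <;>
    norm_num [eigenProj, PauliType.mat, Matrix.mul_apply, Matrix.one_apply]

lemma eigenProj_one_mul_zero (p : PauliType) :
    eigenProj p.mat 1 * eigenProj p.mat 0 = 0 := by
  cases p <;> ext i j <;> fin_cases i <;> fin_cases j <;>
    norm_num [eigenProj, PauliType.mat, Matrix.mul_apply, Matrix.one_apply]

/-- The operator that an ancilla undergoes when it is prepared, used to measure a Pauli operator
with outcome `b`, and projected. -/
noncomputable def readout (p : PauliType) (b : Fin 2) : Matrix (Fin 2) (Fin 2) ℂ :=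
  (2 : ℂ) • (eigenProj p.mat b * eigenProj p.dual.mat 0 * eigenProj p.mat 0)

lemma eigenProj_mul_dual_zero (p : PauliType) (b : Fin 2) :
    eigenProj p.mat b * eigenProj p.dual.mat 0 * eigenProj p.mat 0 =
      (1 / 2 : ℂ) • readout p b := by
  rw [readout, smul_smul]; norm_num

/-- With `ψ_b` the eigenvectors of `p`, the dual Pauli operator exchanges `ψ_0` and `ψ_1`. Hence the
two dual projectors have matrix elements `1/2` and `(-1)^b / 2` between `ψ_b` and `ψ_0`, and the
factor 2 in `readout` normalizes it to `|ψ_b⟩⟨ψ_0|`. -/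
lemma eigenProj_mul_dual_one (p : PauliType) (b : Fin 2) :
    eigenProj p.mat b * eigenProj p.dual.mat 1 * eigenProj p.mat 0 =
      ((1 / 2 : ℂ) * (-1) ^ (b : ℕ)) • readout p b := by
  cases p <;> fin_cases b <;> ext i j <;> fin_cases i <;> fin_cases j <;>
    norm_num [readout, eigenProj, PauliType.mat, PauliType.dual, Matrix.mul_apply,
      Matrix.one_apply]

lemma trace_readout (p : PauliType) (b : Fin 2) :
    (readout p b * eigenProj p.mat 0 * (readout p b).conjTranspose).trace = 1 := by
  have h : (starRingEnd ℂ) 2 = 2 := map_ofNat _ 2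
  cases p <;> fin_cases b <;>
    norm_num [readout, eigenProj, PauliType.mat, PauliType.dual, Matrix.mul_apply,
      Matrix.one_apply, Matrix.trace, Matrix.conjTranspose_apply, h]

lemma eigenProj_conjTranspose (p : PauliType) (b : Fin 2) :
    (eigenProj p.mat b).conjTranspose = eigenProj p.mat b := by
  cases p <;> fin_cases b <;> ext i j <;> fin_cases i <;> fin_cases j <;>
    norm_num [eigenProj, PauliType.mat, Matrix.conjTranspose_apply, Matrix.one_apply]

lemma inv_sqrt_two_mul_self :
    ((1 / Real.sqrt 2 : ℝ) : ℂ) * ((1 / Real.sqrt 2 : ℝ) : ℂ) = 1 / 2 := by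
  rw [← Complex.ofReal_mul, div_mul_div_comm, Real.mul_self_sqrt (by norm_num)]
  norm_num

lemma sum_reset (p : PauliType) (N : Matrix (Fin 2) (Fin 2) ℂ) :
    ∑ j : Fin 2, Matrix.vecMulVec p.ket (Pi.single j 1) * N *
      (Matrix.vecMulVec p.ket (Pi.single j 1)).conjTranspose =
      N.trace • eigenProj p.mat 0 := by
  have h := inv_sqrt_two_mul_self
  have hs : (starRingEnd ℂ) ((1 / Real.sqrt 2 : ℝ) : ℂ) = ((1 / Real.sqrt 2 : ℝ) : ℂ) :=
    Complex.conj_ofReal _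
  cases p <;> ext i j <;> fin_cases i <;> fin_cases j <;>
    simp only [PauliType.ket, Fin.sum_univ_two, Matrix.add_apply, Matrix.mul_apply,
      Matrix.vecMulVec_apply, Matrix.conjTranspose_apply, Matrix.smul_apply, eigenProj,
      PauliType.mat, Matrix.trace, Matrix.diag, Matrix.one_apply, Pi.single_apply] <;>
    simp [-one_div, -Complex.ofReal_div, -Complex.ofReal_inv, hs, -Complex.ofReal_one] <;>
    first | ring1 | linear_combination (N 0 0 + N 1 1) * h

end OneQubit

section Controlled

variable {V : Type} [Fintype V] [DecidableEq V]

/-- The Pauli operator of type `p` on `S`, controlled by the qubit `a` in the dual basis. -/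
noncomputable def controlled (p : PauliType) (a : V) (S : Finset V) : Operator V :=
  onQubit a (eigenProj p.dual.mat 0) + onQubit a (eigenProj p.dual.mat 1) * pauliString p S

lemma pauliString_singleton (p : PauliType) (q : V) : pauliString p {q} = onQubit q p.mat := by
  simp [pauliString, onQubit]

lemma cnotOp_eq_controlled_X {a q : V} : cnotOp a q = controlled .X a {q} := by
  rw [cnotOp, controlled, pauliString_singleton]
  congr 3
  all_goals
    ext i j; fin_cases i <;> fin_cases j <;>
      norm_num [eigenProj, PauliType.mat, PauliType.dual, Matrix.one_apply]

/-- Expanding both sides gives the same half-sum of `1`, `Z` on `q`, `X` on `a` and minus their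
product: a `CNOT` is also a `Z` on its control, controlled by its target in the X basis. -/
lemma cnotOp_eq_controlled_Z {a q : V} (h : a ≠ q) : cnotOp q a = controlled .Z a {q} := by
  rw [cnotOp_eq_controlled_X, controlled, controlled, pauliString_singleton,
    pauliString_singleton, onQubit_eigenProj, onQubit_eigenProj, onQubit_eigenProj,
    onQubit_eigenProj]
  have hc := (commute_onQubit h PauliType.X.mat PauliType.Z.mat).eq
  simp only [eigenProj, PauliType.dual, Fin.val_zero, Fin.val_one, pow_zero, pow_one, one_smul,
    neg_smul, smul_mul_assoc, add_mul, one_mul, neg_mul, hc, smul_add, smul_neg]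
  abel

lemma controlled_empty (p : PauliType) (a : V) : controlled p a ∅ = 1 := by
  rw [controlled, pauliString_empty, mul_one, ← onQubit_add, ← onQubit_one a]
  congr 1
  cases p <;> ext i j <;> fin_cases i <;> fin_cases j <;>
    norm_num [eigenProj, PauliType.mat, PauliType.dual, Matrix.one_apply]

/-- The two projectors on the ancilla are orthogonal, so the mixed terms of the product vanish. -/
lemma controlled_insert (p : PauliType) {a q : V} {S : Finset V} (haq : a ≠ q) (hq : q ∉ S) :
    controlled p a {q} * controlled p a S = controlled p a (insert q S) := by
  rw [controlled, controlled, controlled, pauliString_singleton, ← pauliString_cons p hq]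
  have hc := fun M => (commute_onQubit haq M p.mat).eq
  have h00 := onQubit_mul a (eigenProj p.dual.mat 0) (eigenProj p.dual.mat 0)
  have h11 := onQubit_mul a (eigenProj p.dual.mat 1) (eigenProj p.dual.mat 1)
  have h01 := onQubit_mul a (eigenProj p.dual.mat 0) (eigenProj p.dual.mat 1)
  have h10 := onQubit_mul a (eigenProj p.dual.mat 1) (eigenProj p.dual.mat 0)
  rw [eigenProj_mul_self] at h00 h11
  rw [eigenProj_zero_mul_one, onQubit_zero] at h01
  rw [eigenProj_one_mul_zero, onQubit_zero] at h10
  rw [add_mul, mul_add, mul_add, h00, ← mul_assoc, h01, zero_mul, add_zero,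
    mul_assoc _ (onQubit q p.mat), ← hc, ← mul_assoc, h10, zero_mul, zero_add,
    mul_assoc _ (onQubit q p.mat), ← mul_assoc (onQubit q p.mat), ← hc,
    mul_assoc _ (onQubit q p.mat), ← mul_assoc, h11]

lemma controlled_list_prod (p : PauliType) {a : V} (l : List V) (hl : l.Nodup) (ha : a ∉ l) :
    (l.map fun q => controlled p a {q}).prod = controlled p a l.toFinset := by
  induction l with
  | nil => simp [controlled_empty]
  | cons q l ih =>
    rw [List.nodup_cons] at hl
    rw [List.mem_cons, not_or] at ha
    rw [List.map_cons, List.prod_cons, ih hl.2 ha.2, List.toFinset_cons,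
      controlled_insert p ha.1 (by simpa using hl.1)]

lemma commute_onQubit_controlled {a a' : V} (haa' : a ≠ a') {S : Finset V} (ha : a ∉ S)
    (M : Matrix (Fin 2) (Fin 2) ℂ) (p : PauliType) :
    Commute (onQubit a M) (controlled p a' S) :=
  (commute_onQubit haa' _ _).add_right
    ((commute_onQubit haa' _ _).mul_right (commute_onQubit_pauliString ha _ _))

lemma commute_controlled (p : PauliType) {a a' : V} {S S' : Finset V} (ha' : a' ∉ S)
    (haS' : a ∉ S') :
    Commute (controlled p a S) (controlled p a' S') := by
  have h1 : ∀ b b' : Fin 2, Commute (onQubit a (eigenProj p.dual.mat b))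
      (onQubit a' (eigenProj p.dual.mat b')) := by
    intro b b'
    by_cases h : a = a'
    · subst h
      rw [onQubit_eigenProj, onQubit_eigenProj]
      exact commute_eigenProj (Commute.refl _) _ _
    · exact commute_onQubit h _ _
  have h2 : Commute (pauliString p S) (controlled p a' S') :=
    (commute_onQubit_pauliString ha' _ _).symm.add_right
      ((commute_onQubit_pauliString ha' _ _).symm.mul_right (commute_pauliString p S S'))
  have h3 : ∀ b, Commute (onQubit a (eigenProj p.dual.mat b)) (controlled p a' S') := fun b =>
    (h1 b 0).add_right ((h1 b 1).mul_right (commute_onQubit_pauliString haS' _ _))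
  exact (h3 0).add_left ((h3 1).mul_left h2)

/-- The two branches of the control return the same ancilla operator up to the sign `(-1)^b`, so the
data part is half of `1 + (-1)^b P`. -/
lemma measure_controlled (p : PauliType) {a : V} {S : Finset V} (ha : a ∉ S) (b : Fin 2) :
    onQubit a (eigenProj p.mat b) * controlled p a S * onQubit a (eigenProj p.mat 0) =
      onQubit a (readout p b) * eigenProj (pauliString p S) b := by
  have hc := fun M => (commute_onQubit_pauliString ha M p).eq
  rw [controlled, mul_add, add_mul, onQubit_mul, onQubit_mul, eigenProj_mul_dual_zero,
    ← mul_assoc, mul_assoc _ (pauliString p S), ← hc, ← mul_assoc, onQubit_mul, onQubit_mul,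
    eigenProj_mul_dual_one, onQubit_smul, onQubit_smul, eigenProj, mul_smul_comm, mul_add,
    mul_one, mul_smul_comm, smul_add, smul_smul, smul_mul_assoc]

end Controlled

/-! ### The action of preparations, gates and measurements -/

section ListProd

variable {ι M : Type} [Monoid M]

/-- No commutation among the `f i`, or among the `g i`, is needed. This lets X and Z couplings be
regrouped in their given order. -/
lemma list_prod_mul_distrib (L : List ι) (hL : L.Nodup) (f g : ι → M)
    (h : ∀ i ∈ L, ∀ j ∈ L, i ≠ j → Commute (f i) (g j)) :
    (L.map f).prod * (L.map g).prod = (L.map fun i => f i * g i).prod := by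
  induction L with
  | nil => simp
  | cons i L ih =>
    rw [List.nodup_cons] at hL
    have hc : Commute (L.map f).prod (g i) := by
      refine (Commute.list_prod_right _ _ fun x hx => ?_).symm
      obtain ⟨j, hj, rfl⟩ := List.mem_map.1 hx
      exact (h j (by simp [hj]) i (by simp) fun e => hL.1 (e ▸ hj)).symm
    simp only [List.map_cons, List.prod_cons]
    rw [← ih hL.2 fun i hi j hj => h i (by simp [hi]) j (by simp [hj]), mul_assoc (f i),
      ← mul_assoc _ (g i), hc.eq]
    simp only [mul_assoc]

end ListProd

section Channels

variable {V R : Type} [Fintype V] [DecidableEq V] [DecidableEq R]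

/-- The reset of the qubit `q` to the `+1` eigenvector of `p`. -/
noncomputable def resetMap (p : PauliType) (q : V) : Operator V →ₗ[ℂ] Operator V :=
  ∑ j : Fin 2, LinearMap.mulLeftRight ℂ
    (onQubit q (Matrix.vecMulVec p.ket (Pi.single j 1)),
      (onQubit q (Matrix.vecMulVec p.ket (Pi.single j 1))).conjTranspose)

lemma resetMap_apply (p : PauliType) (q : V) (ρ : Operator V) :
    resetMap p q ρ = ∑ j : Fin 2, onQubit q (Matrix.vecMulVec p.ket (Pi.single j 1)) * ρ *
      (onQubit q (Matrix.vecMulVec p.ket (Pi.single j 1))).conjTranspose := by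
  simp [resetMap, LinearMap.mulLeftRight_apply]

lemma apply_prep (p : PauliType) (q : V) (σ : HybridState V R) :
    (Op.prep p q).apply σ = fun m => resetMap p q (σ m) := by
  simp only [resetMap_apply]
  rfl

lemma apply_meas (p : PauliType) (q : V) (r : R) (σ : HybridState V R) (m : R → Fin 2) :
    (Op.meas p q r).apply σ m =
      onQubit q (eigenProj p.mat (m r)) * σ (Function.update m r 0) *
          (onQubit q (eigenProj p.mat (m r))).conjTranspose +
        onQubit q (eigenProj p.mat (m r)) * σ (Function.update m r 1) *
          (onQubit q (eigenProj p.mat (m r))).conjTranspose :=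
  Fin.sum_univ_two _

lemma foldl_prep (l : List (PauliType × V)) (σ : HybridState V R) :
    (l.map fun a => Op.prep (R := R) a.1 a.2).foldl (fun τ o => o.apply τ) σ =
      fun m => (l.foldl (fun f a => resetMap a.1 a.2 ∘ₗ f) LinearMap.id) (σ m) := by
  induction l using List.reverseRecOn with
  | nil => simp
  | append_singleton l a ih =>
    simp only [List.map_append, List.foldl_append, ih, List.map_cons, List.map_nil,
      List.foldl_cons, List.foldl_nil, apply_prep, LinearMap.comp_apply]

lemma foldl_unitary {ι : Type} (op : ι → Op V R) (K : ι → Operator V)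
    (h : ∀ i (σ : HybridState V R), (op i).apply σ = fun m => K i * σ m * (K i).conjTranspose)
    (l : List ι) (σ : HybridState V R) :
    (l.map op).foldl (fun τ o => o.apply τ) σ =
      fun m => (l.reverse.map K).prod * σ m * ((l.reverse.map K).prod).conjTranspose := by
  induction l using List.reverseRecOn with
  | nil => simp
  | append_singleton l a ih =>
    simp only [List.map_append, List.foldl_append, ih, List.map_cons, List.map_nil,
      List.foldl_cons, List.foldl_nil, h, List.reverse_append, List.reverse_cons,
      List.reverse_nil, List.nil_append, List.cons_append, List.prod_cons,
      Matrix.conjTranspose_mul]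
    simp only [mul_assoc]

/-- Bits start at `0`, so only outcomes supported on the bits written so far carry a nonzero state.
-/
lemma foldl_meas [Fintype R] (p : R → PauliType) (q : R → V) (l : List R) (hl : l.Nodup)
    (τ : Operator V) (m : R → Fin 2) :
    (l.map fun r => Op.meas (p r) (q r) r).foldl (fun τ o => o.apply τ)
      (fun m => if m = 0 then τ else 0) m =
      if ∀ r ∉ l, m r = 0 then
        (l.reverse.map fun r => onQubit (q r) (eigenProj (p r).mat (m r))).prod * τ *
          ((l.reverse.map fun r => onQubit (q r) (eigenProj (p r).mat (m r))).prod).conjTranspose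
      else 0 := by
  induction l using List.reverseRecOn generalizing m with
  | nil => simp [funext_iff]
  | append_singleton l a ih =>
    rw [List.nodup_append] at hl
    have hal : a ∉ l := fun h => hl.2.2 a h a (by simp) rfl
    simp only [List.map_append, List.foldl_append, List.map_cons, List.map_nil,
      List.foldl_cons, List.foldl_nil, apply_meas, List.reverse_append, List.reverse_cons,
      List.reverse_nil, List.nil_append, List.cons_append, List.prod_cons,
      Matrix.conjTranspose_mul, ih hl.1]
    -- Bit `a` has not been written before its own measurement, so the summand with previous value
    -- `1` vanishes.
    have h1 : ¬ ∀ r ∉ l, Function.update m a 1 r = 0 := fun h => by simpa using h a hal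
    have h0 : (∀ r ∉ l, Function.update m a 0 r = 0) ↔ ∀ r ∉ l ++ [a], m r = 0 := by
      constructor
      · intro h r hr
        rw [List.mem_append, not_or, List.mem_singleton] at hr
        simpa [hr.2] using h r hr.1
      · intro h r hr
        by_cases e : r = a
        · simp [e]
        · simpa [e] using h r (by simp [hr, e])
    have hK : (l.reverse.map fun r =>
          onQubit (q r) (eigenProj (p r).mat (Function.update m a 0 r))) =
        l.reverse.map fun r => onQubit (q r) (eigenProj (p r).mat (m r)) := by
      refine List.map_congr_left fun r hr => ?_
      rw [Function.update_of_ne]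
      rintro rfl
      exact hal (List.mem_reverse.1 hr)
    rw [if_neg h1, mul_zero, zero_mul, add_zero, hK]
    by_cases h : ∀ r ∉ l ++ [a], m r = 0
    · rw [if_pos h, if_pos (h0.2 h)]
      simp only [mul_assoc]
    · rw [if_neg h, if_neg fun h' => h (h0.1 h')]
      simp

end Channels

/-! ### Resets and products of operators on the ancillas -/

section Ancillas

variable {D A : Type} [Fintype D] [DecidableEq D] [Fintype A] [DecidableEq A]

lemma update_mul_mul_update (N : A → Matrix (Fin 2) (Fin 2) ℂ) (a : A)
    (K K' : Matrix (Fin 2) (Fin 2) ℂ) :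
    (fun a' => (Function.update 1 a K : A → _) a' * N a' * (Function.update 1 a K' : A → _) a') =
      Function.update N a (K * N a * K') := by
  ext1 a'
  by_cases h : a' = a
  · subst h; simp
  · simp [h]

lemma update_conjTranspose (a : A) (K : Matrix (Fin 2) (Fin 2) ℂ) :
    (fun a' => ((Function.update 1 a K : A → _) a').conjTranspose) =
      (Function.update 1 a K.conjTranspose : A → Matrix (Fin 2) (Fin 2) ℂ) := by
  ext1 a'
  by_cases h : a' = a
  · subst h; simp
  · simp [h]

lemma extend_update_add (R : Operator D) (N : A → Matrix (Fin 2) (Fin 2) ℂ) (a : A)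
    (K K' : Matrix (Fin 2) (Fin 2) ℂ) :
    extend R (Function.update N a (K + K')) =
      extend R (Function.update N a K) + extend R (Function.update N a K') := by
  have h : ∀ (K : Matrix (Fin 2) (Fin 2) ℂ) (x y : D ⊕ A → Fin 2),
      ∏ a', Function.update N a K a' (x (.inr a')) (y (.inr a')) =
        K (x (.inr a)) (y (.inr a)) *
          ∏ a' ∈ Finset.univ.erase a, N a' (x (.inr a')) (y (.inr a')) := by
    intro K x y
    rw [← Finset.mul_prod_erase _ _ (Finset.mem_univ a), Function.update_self]
    congr 1
    refine Finset.prod_congr rfl fun a' ha' => ?_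
    rw [Function.update_of_ne (Finset.ne_of_mem_erase ha')]
  ext x y
  simp only [extend, Matrix.of_apply, Matrix.add_apply, h]
  ring

lemma resetMap_extend (p : PauliType) (a : A) (R : Operator D)
    (N : A → Matrix (Fin 2) (Fin 2) ℂ) :
    resetMap p (.inr a) (extend R N) =
      extend R (Function.update N a ((N a).trace • eigenProj p.mat 0)) := by
  rw [resetMap_apply, ← sum_reset, Fin.sum_univ_two, Fin.sum_univ_two, extend_update_add]
  simp only [onQubit_inr, extend_conjTranspose, extend_mul, update_conjTranspose,
    update_mul_mul_update, Matrix.conjTranspose_one, one_mul, mul_one]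

lemma foldl_resetMap_extend (ty : A → PauliType) (l : List A) (hl : l.Nodup) (R : Operator D)
    (N : A → Matrix (Fin 2) (Fin 2) ℂ) :
    ((l.map fun a => (ty a, (Sum.inr a : D ⊕ A))).foldl
      (fun f a => resetMap a.1 a.2 ∘ₗ f) LinearMap.id) (extend R N) =
      extend R fun a => if a ∈ l then (N a).trace • eigenProj (ty a).mat 0 else N a := by
  induction l using List.reverseRecOn with
  | nil => simp
  | append_singleton l a ih =>
    rw [List.nodup_append] at hl
    have hal : a ∉ l := fun h => hl.2.2 a h a (by simp) rfl
    simp only [List.map_append, List.foldl_append, List.map_cons, List.map_nil,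
      List.foldl_cons, List.foldl_nil, LinearMap.comp_apply, ih hl.1, resetMap_extend]
    congr 1
    ext1 a'
    by_cases h : a' = a
    · subst h; simp [hal]
    · simp [h]

lemma traceOut_add (ρ σ : Operator (D ⊕ A)) :
    traceOut (ρ + σ) = traceOut ρ + traceOut σ := by
  ext x y
  simp [traceOut, Finset.sum_add_distrib]

lemma traceOut_smul (c : ℂ) (ρ : Operator (D ⊕ A)) : traceOut (c • ρ) = c • traceOut ρ := by
  ext x y
  simp [traceOut, Finset.mul_sum]

/-- Resetting all ancillas discards their state. -/
lemma foldl_resetMap (ty : A → PauliType) (l : List A) (hl : l.Nodup) (hmem : ∀ a, a ∈ l)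
    (ρ : Operator (D ⊕ A)) :
    ((l.map fun a => (ty a, (Sum.inr a : D ⊕ A))).foldl
      (fun f a => resetMap a.1 a.2 ∘ₗ f) LinearMap.id) ρ =
      extend (traceOut ρ) fun a => eigenProj (ty a).mat 0 := by
  have key : ∀ (R : Operator D) (N : A → Matrix (Fin 2) (Fin 2) ℂ),
      ((l.map fun a => (ty a, (Sum.inr a : D ⊕ A))).foldl
        (fun f a => resetMap a.1 a.2 ∘ₗ f) LinearMap.id) (extend R N) =
      extend (traceOut (extend R N)) fun a => eigenProj (ty a).mat 0 := by
    intro R N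
    rw [foldl_resetMap_extend ty l hl, traceOut_extend, extend_smul_left, ← extend_smul_right]
    simp [hmem]
  have hsm : ∀ x y (c : ℂ), (Matrix.single x y c : Operator (D ⊕ A)) = c • Matrix.single x y 1 :=
    fun x y c => by simp [Matrix.smul_single]
  -- Both sides are linear in `ρ`, and matrix units are products; entanglement between data and
  -- ancillas therefore needs no separate treatment.
  induction ρ using Matrix.induction_on' with
  | h_zero =>
    have h0 : (0 : Operator (D ⊕ A)) = extend 0 fun _ => 0 := by ext x y; simp [extend]
    rw [h0, key]
  | h_add ρ σ h1 h2 => rw [map_add, h1, h2, traceOut_add, extend_add_left]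
  | h_std_basis x y c =>
    rw [hsm, map_smul, single_eq_extend, key, traceOut_smul, extend_smul_left]

lemma prod_onQubit_mul_extend (N : A → Matrix (Fin 2) (Fin 2) ℂ)
    (hN : ∀ a, N a * N a = N a) (l : List A) (R : Operator D) :
    (l.map fun a => onQubit (Sum.inr a : D ⊕ A) (N a)).prod * extend R N = extend R N := by
  induction l with
  | nil => simp
  | cons a l ih =>
    rw [List.map_cons, List.prod_cons, mul_assoc, ih, onQubit_inr, extend_mul, one_mul]
    congr 1
    ext1 a'
    by_cases h : a' = a
    · subst h; simp [hN]
    · simp [h]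

lemma prod_onQubit_inr (N : A → Matrix (Fin 2) (Fin 2) ℂ) (l : List A) (hl : l.Nodup) :
    (l.map fun a => onQubit (Sum.inr a : D ⊕ A) (N a)).prod =
      extend 1 fun a => if a ∈ l then N a else 1 := by
  induction l with
  | nil => simp [extend_one]
  | cons a l ih =>
    rw [List.nodup_cons] at hl
    rw [List.map_cons, List.prod_cons, ih hl.2, onQubit_inr, extend_mul, one_mul]
    congr 1
    ext1 a'
    by_cases h : a' = a
    · subst h; simp [hl.1]
    · simp [h]

lemma prod_extend {ι : Type} (R : ι → Operator D) (l : List ι) :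
    (l.map fun i => extend (R i) fun _ : A => 1).prod = extend (l.map R).prod fun _ => 1 := by
  induction l with
  | nil => simp [extend_one]
  | cons i l ih => rw [List.map_cons, List.prod_cons, ih, extend_mul]; simp

lemma eigenProj_extend (P : Operator D) (b : Fin 2) :
    eigenProj (extend P fun _ : A => 1) b = extend (eigenProj P b) fun _ => 1 := by
  simp only [eigenProj, extend_smul_left, extend_add_left, extend_one]

end Ancillas

/-! ### The syndrome measurement circuit -/

section Gates

variable {D A : Type} [Fintype D] [DecidableEq D] [Fintype A] [DecidableEq A]

/-- The `CNOT` gate between the ancilla `e.1` and the data qubit `e.2`; the ancilla is the control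
iff it measures an operator of type `X`. -/
def gate (ty : A → PauliType) (e : A × D) : Op (D ⊕ A) A :=
  match ty e.1 with
  | .X => .cnot (.inr e.1) (.inl e.2) (by simp)
  | .Z => .cnot (.inl e.2) (.inr e.1) (by simp)

/-- The unitary operator of a gate. -/
noncomputable def gateOp (ty : A → PauliType) (e : A × D) : Operator (D ⊕ A) :=
  controlled (ty e.1) (.inr e.1) {.inl e.2}

lemma apply_gate (ty : A → PauliType) (e : A × D) (σ : HybridState (D ⊕ A) A) :
    (gate ty e).apply σ = fun m => gateOp ty e * σ m * (gateOp ty e).conjTranspose := by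
  unfold gate gateOp
  cases h : ty e.1
  · simp only [Op.apply, cnotOp_eq_controlled_X]
  · simp only [Op.apply, cnotOp_eq_controlled_Z (a := (Sum.inr e.1 : D ⊕ A)) (q := Sum.inl e.2)
      (by simp)]

lemma qubits_gate (ty : A → PauliType) (e : A × D) :
    (gate ty e).qubits = {.inr e.1, .inl e.2} := by
  unfold gate
  cases h : ty e.1
  · rfl
  · exact Set.pair_comm _ _

lemma bits_gate (ty : A → PauliType) (e : A × D) : (gate ty e).bits = ∅ := by
  unfold gate
  cases h : ty e.1 <;> rfl

lemma gate_eq_cnot {ty : A → PauliType} {e : A × D} {c t : D ⊕ A} {h : c ≠ t}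
    (he : gate ty e = .cnot c t h) : s(c, t) = s(.inl e.2, .inr e.1) := by
  unfold gate at he
  cases hp : ty e.1 <;> simp only [hp, Op.cnot.injEq] at he <;> obtain ⟨rfl, rfl⟩ := he
  · exact Sym2.eq_swap
  · rfl

/-- The support of an operator, as a set of qubits of the enlarged register. -/
def liftSupp (S : A → Finset D) (a : A) : Finset (D ⊕ A) :=
  (S a).map ⟨Sum.inl, Sum.inl_injective⟩

lemma inr_notMem_liftSupp (S : A → Finset D) (a a' : A) : Sum.inr a' ∉ liftSupp S a := by
  simp [liftSupp]

lemma prod_gateOp_fiber (ty : A → PauliType) (S : A → Finset D) (a : A) :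
    (((S a).toList.map fun q => (a, q)).map (gateOp ty)).prod =
      controlled (ty a) (.inr a) (liftSupp S a) := by
  have h := controlled_list_prod (ty a) (a := (Sum.inr a : D ⊕ A)) ((S a).toList.map Sum.inl)
    ((Finset.nodup_toList _).map Sum.inl_injective) (by simp)
  rw [List.map_map] at h ⊢
  have e : ((S a).toList.map Sum.inl).toFinset = liftSupp S a := by
    ext x; simp [liftSupp]
  rw [e] at h
  exact h

/-- All gates of one type, in whatever order, make up the controlled Pauli operators
of this type. -/
lemma prod_gateOp (ty : A → PauliType) (S : A → Finset D) (p : PauliType) (As : List A)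
    (hAs : As.Nodup) (hty : ∀ a ∈ As, ty a = p) (l : List (A × D)) (hl : l.Nodup)
    (hmem : ∀ e, e ∈ l ↔ e.1 ∈ As ∧ e.2 ∈ S e.1) :
    (l.map (gateOp ty)).prod =
      (As.map fun a => controlled (ty a) (.inr a) (liftSupp S a)).prod := by
  let l' : List (A × D) := As.flatMap fun a => (S a).toList.map fun q => (a, q)
  have hl' : l'.Nodup := by
    refine List.nodup_flatMap.2 ⟨fun a _ => (Finset.nodup_toList _).map
      fun x y h => (Prod.ext_iff.1 h).2, hAs.imp fun {a b} hab => ?_⟩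
    rw [Function.onFun, List.disjoint_left]
    intro e h1 h2
    obtain ⟨_, _, rfl⟩ := List.mem_map.1 h1
    obtain ⟨_, _, h⟩ := List.mem_map.1 h2
    exact hab (Prod.ext_iff.1 h).1.symm
  have hperm : l.Perm l' := (List.perm_ext_iff_of_nodup hl hl').2 fun e => by
    rw [hmem]
    simp only [l', List.mem_flatMap, List.mem_map, Finset.mem_toList]
    constructor
    · rintro ⟨h1, h2⟩
      exact ⟨e.1, h1, e.2, h2, rfl⟩
    · rintro ⟨a, h1, q, h2, rfl⟩
      exact ⟨h1, h2⟩
  have hcomm : (l.map (gateOp ty)).Pairwise Commute := by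
    rw [List.pairwise_map]
    refine List.Pairwise.imp_of_mem (fun {e e'} he he' _ => ?_) hl
    have h1 := hty _ ((hmem e).1 he).1
    have h2 := hty _ ((hmem e').1 he').1
    rw [gateOp, gateOp, h1, h2]
    exact commute_controlled p (by simp) (by simp)
  rw [(hperm.map _).prod_eq' hcomm]
  simp only [l', List.flatMap_def, List.map_flatten, List.prod_flatten, List.map_map]
  congr 1
  refine List.map_congr_left fun a _ => ?_
  rw [← prod_gateOp_fiber, List.map_map]
  simp [Function.comp_def]

/-- Preparing all ancillas, applying the gates of type `X`, then those of type `Z`, and measuring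
all ancillas projects the data qubits onto a joint eigenspace. -/
theorem traceOut_foldl (ty : A → PauliType) (S : A → Finset D) (LX LZ : List A)
    (hnd : (LZ ++ LX).Nodup) (hall : ∀ a, a ∈ LZ ++ LX) (hX : ∀ a ∈ LX, ty a = .X)
    (hZ : ∀ a ∈ LZ, ty a = .Z) (gX gZ : List (A × D)) (hgX : gX.Nodup) (hgZ : gZ.Nodup)
    (hmX : ∀ e, e ∈ gX ↔ e.1 ∈ LX ∧ e.2 ∈ S e.1) (hmZ : ∀ e, e ∈ gZ ↔ e.1 ∈ LZ ∧ e.2 ∈ S e.1)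
    (ρ : Operator (D ⊕ A)) (s : A → Fin 2) :
    let K := ((LZ ++ LX).map fun a => eigenProj (pauliString (ty a) (S a)) (s a)).prod
    traceOut (((((LZ ++ LX).map fun a => Op.prep (R := A) (ty a) (Sum.inr a : D ⊕ A)) ++
        gX.map (gate ty) ++ gZ.map (gate ty) ++
        (LZ ++ LX).reverse.map fun a => Op.meas (ty a) (Sum.inr a : D ⊕ A) a).foldl
          (fun τ o => o.apply τ) fun m => if m = 0 then ρ else 0) s) =
      K * traceOut ρ * K.conjTranspose := by
  intro K
  set L := LZ ++ LX with hL
  let M : A → Operator (D ⊕ A) := fun a => onQubit (.inr a) (eigenProj (ty a).mat (s a))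
  let U : A → Operator (D ⊕ A) := fun a => controlled (ty a) (.inr a) (liftSupp S a)
  let P : A → Operator (D ⊕ A) := fun a => onQubit (.inr a) (eigenProj (ty a).mat 0)
  let B : A → Operator (D ⊕ A) := fun a => onQubit (.inr a) (readout (ty a) (s a))
  let E : A → Operator (D ⊕ A) := fun a => eigenProj (pauliString (ty a) (liftSupp S a)) (s a)
  let τ : Operator (D ⊕ A) := extend (traceOut ρ) fun a => eigenProj (ty a).mat 0
  have hprep : (L.map fun a => Op.prep (R := A) (ty a) (Sum.inr a : D ⊕ A)).foldl
      (fun τ o => o.apply τ) (fun m => if m = 0 then ρ else 0) =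
      fun m => if m = 0 then τ else 0 := by
    have h := foldl_prep (R := A) (L.map fun a => (ty a, (Sum.inr a : D ⊕ A)))
      (fun m => if m = 0 then ρ else 0)
    rw [List.map_map] at h
    refine h.trans (funext fun m => ?_)
    split_ifs
    · exact foldl_resetMap ty L hnd hall ρ
    · exact map_zero _
  -- Later gates multiply on the left, hence the reversed lists here and the Z ancillas first in
  -- `L`.
  have hUX : (gX.reverse.map (gateOp ty)).prod = (LX.map U).prod :=
    prod_gateOp ty S .X LX hnd.of_append_right hX _ (List.nodup_reverse.2 hgX) (by simpa using hmX)
  have hUZ : (gZ.reverse.map (gateOp ty)).prod = (LZ.map U).prod :=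
    prod_gateOp ty S .Z LZ hnd.of_append_left hZ _ (List.nodup_reverse.2 hgZ) (by simpa using hmZ)
  have hU : (gX.map (gate ty) ++ gZ.map (gate ty)).foldl (fun τ o => o.apply τ)
      (fun m => if m = 0 then τ else 0) =
      fun m => if m = 0 then (L.map U).prod * τ * ((L.map U).prod).conjTranspose else 0 := by
    rw [List.foldl_append, foldl_unitary _ _ (apply_gate ty), foldl_unitary _ _ (apply_gate ty),
      hUX, hUZ]
    funext m
    by_cases hm : m = 0
    · simp only [if_pos hm]
      rw [hL, List.map_append, List.prod_append, Matrix.conjTranspose_mul]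
      simp only [mul_assoc]
    · simp [hm]
  have hMUP : (L.map M).prod * (L.map U).prod * (L.map P).prod =
      extend K fun a => readout (ty a) (s a) := by
    have ne : ∀ {a a' : A}, a ≠ a' → (Sum.inr a : D ⊕ A) ≠ Sum.inr a' := fun h h' =>
      h (Sum.inr_injective h')
    have hUc : ∀ (a a' : A) (N : Matrix (Fin 2) (Fin 2) ℂ), a ≠ a' →
        Commute (onQubit (Sum.inr a) N) (U a') := fun a a' N h =>
      commute_onQubit_controlled (ne h) (inr_notMem_liftSupp S _ _) _ _
    -- Interleaving the three products brings together the factors `M a * U a * P a` of each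
    -- ancilla.
    rw [list_prod_mul_distrib L hnd M U fun a _ a' _ h => hUc a a' _ h,
      list_prod_mul_distrib L hnd _ P fun a _ a' _ h =>
        (commute_onQubit (ne h) _ _).mul_left (hUc a' a _ h.symm).symm]
    have hBE : ∀ a, M a * U a * P a = B a * E a := fun a =>
      measure_controlled (ty a) (inr_notMem_liftSupp S _ _) (s a)
    rw [show (fun a => M a * U a * P a) = fun a => B a * E a from funext hBE]
    rw [← list_prod_mul_distrib L hnd B E fun a _ a' _ _ =>
      commute_eigenProj_right (commute_onQubit_pauliString (inr_notMem_liftSupp S _ _) _ _) _]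
    have hE : ∀ a, E a = extend (eigenProj (pauliString (ty a) (S a)) (s a)) fun _ => 1 :=
      fun a => by rw [← eigenProj_extend, ← pauliString_map_inl]; rfl
    rw [show E = _ from funext hE, prod_onQubit_inr _ L hnd, prod_extend, extend_mul, one_mul]
    simp only [hall, if_true, mul_one]
    rfl
  have hP : ∀ R : Operator D, (L.map P).prod * extend R (fun a => eigenProj (ty a).mat 0) =
      extend R fun a => eigenProj (ty a).mat 0 := fun R =>
    prod_onQubit_mul_extend (fun a => eigenProj (ty a).mat 0)
      (fun a => eigenProj_mul_self _ _) L R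
  have hP' : τ * ((L.map P).prod).conjTranspose = τ := by
    rw [← Matrix.conjTranspose_conjTranspose τ, ← Matrix.conjTranspose_mul]
    congr 1
    simp only [τ, extend_conjTranspose, eigenProj_conjTranspose]
    exact hP _
  -- The freshly prepared state is fixed by the projectors `P`; they can be inserted on both sides
  -- to supply the right-hand factor that `measure_controlled` needs.
  have hτ : (L.map P).prod * τ * ((L.map P).prod).conjTranspose = τ := by
    rw [mul_assoc, hP', hP]
  rw [List.append_assoc, List.append_assoc, ← List.append_assoc (gX.map _), List.foldl_append,
    List.foldl_append, hprep, hU, foldl_meas _ _ _ (List.nodup_reverse.2 hnd),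
    if_pos fun r hr => absurd (List.mem_reverse.2 (hall r)) hr, List.reverse_reverse]
  have hfin : (L.map M).prod * ((L.map U).prod * τ * ((L.map U).prod).conjTranspose) *
      ((L.map M).prod).conjTranspose =
      extend (K * traceOut ρ * K.conjTranspose) fun a =>
        readout (ty a) (s a) * eigenProj (ty a).mat 0 * (readout (ty a) (s a)).conjTranspose := by
    have h1 : (L.map M).prod * ((L.map U).prod * τ * ((L.map U).prod).conjTranspose) *
        ((L.map M).prod).conjTranspose =
        ((L.map M).prod * (L.map U).prod * (L.map P).prod) * τ *
          ((L.map M).prod * (L.map U).prod * (L.map P).prod).conjTranspose := by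
      conv_lhs => rw [← hτ]
      simp only [Matrix.conjTranspose_mul, mul_assoc]
    rw [h1, hMUP, extend_conjTranspose, extend_mul, extend_mul]
  refine (congrArg traceOut hfin).trans ?_
  rw [traceOut_extend]
  simp [trace_readout]

end Gates

/-! ### The circuit scheduled by a colouring, its depth and its layout -/

section Circuit

variable {D A : Type} [Fintype D] [DecidableEq D] [Fintype A] [DecidableEq A]

/-- The incident pairs of colour `k` whose first component is in `L`. -/
noncomputable def colorClass (S : A → Finset D) (c : A → D → ℕ) (L : List A) (k : ℕ) :
    List (A × D) :=
  (Finset.univ.filter fun e : A × D => e.1 ∈ L ∧ e.2 ∈ S e.1 ∧ c e.1 e.2 = k).toList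

lemma mem_colorClass {S : A → Finset D} {c : A → D → ℕ} {L : List A} {k : ℕ} {e : A × D} :
    e ∈ colorClass S c L k ↔ e.1 ∈ L ∧ e.2 ∈ S e.1 ∧ c e.1 e.2 = k := by
  simp [colorClass]

lemma nodup_colorClass (S : A → Finset D) (c : A → D → ℕ) (L : List A) (k : ℕ) :
    (colorClass S c L k).Nodup :=
  Finset.nodup_toList _

lemma nodup_flatMap_colorClass (S : A → Finset D) (c : A → D → ℕ) (L : List A) (k : ℕ) :
    ((List.range k).flatMap (colorClass S c L)).Nodup := by
  refine List.nodup_flatMap.2 ⟨fun i _ => nodup_colorClass S c L i,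
    List.nodup_range.imp fun {i j} hij => ?_⟩
  rw [Function.onFun, List.disjoint_left]
  intro e h1 h2
  rw [mem_colorClass] at h1 h2
  exact hij (h1.2.2.symm.trans h2.2.2)

lemma mem_flatMap_colorClass {S : A → Finset D} {c : A → D → ℕ} {k : ℕ}
    (hc : ∀ a, ∀ q ∈ S a, c a q < k) (L : List A) (e : A × D) :
    e ∈ (List.range k).flatMap (colorClass S c L) ↔ e.1 ∈ L ∧ e.2 ∈ S e.1 := by
  simp only [List.mem_flatMap, List.mem_range, mem_colorClass]
  constructor
  · rintro ⟨_, _, h1, h2, _⟩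
    exact ⟨h1, h2⟩
  · rintro ⟨h1, h2⟩
    exact ⟨_, hc _ _ h2, h1, h2, rfl⟩

/-- Properness at the ancillas and at the data qubits makes each colour class a matching. -/
lemma pairwise_gate_colorClass (ty : A → PauliType) {S : A → Finset D} {c : A → D → ℕ}
    (hcA : ∀ a, ∀ q ∈ S a, ∀ q' ∈ S a, c a q = c a q' → q = q')
    (hcD : ∀ a a' q, q ∈ S a → q ∈ S a' → c a q = c a' q → a = a') (L : List A) (k : ℕ) :
    ((colorClass S c L k).map (gate ty)).Pairwise fun o o' =>
      Disjoint o.qubits o'.qubits ∧ Disjoint o.bits o'.bits := by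
  rw [List.pairwise_map]
  refine List.Pairwise.imp_of_mem (fun {e e'} he he' hne => ?_) (nodup_colorClass S c L k)
  obtain ⟨a, q⟩ := e
  obtain ⟨a', q'⟩ := e'
  rw [mem_colorClass] at he he'
  obtain ⟨-, h1, h2⟩ := he
  obtain ⟨-, h1', h2'⟩ := he'
  simp only at h1 h1' h2 h2'
  have ha : a ≠ a' := by
    rintro rfl
    exact hne (by rw [hcA a q h1 q' h1' (h2.trans h2'.symm)])
  have hq : q ≠ q' := by
    rintro rfl
    exact hne (by rw [hcD a a' q h1 h1' (h2.trans h2'.symm)])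
  simp [qubits_gate, bits_gate, ha.symm, hq.symm]

/-- The circuit that prepares all ancillas, couples the ancillas of type `X` and then those of
type `Z` to the data qubits, one colour per time step, and measures all ancillas. -/
noncomputable def syndromeCircuit (ty : A → PauliType) (S : A → Finset D) (c : A → D → ℕ) (k : ℕ)
    (LX LZ : List A) (hnd : (LZ ++ LX).Nodup)
    (hcA : ∀ a, ∀ q ∈ S a, ∀ q' ∈ S a, c a q = c a q' → q = q')
    (hcD : ∀ a a' q, q ∈ S a → q ∈ S a' → c a q = c a' q → a = a') : Circuit (D ⊕ A) A where
  steps := [(LZ ++ LX).map fun a => Op.prep (ty a) (Sum.inr a)] ++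
    (List.range k).map (fun i => (colorClass S c LX i).map (gate ty)) ++
    (List.range k).map (fun i => (colorClass S c LZ i).map (gate ty)) ++
    [(LZ ++ LX).reverse.map fun a => Op.meas (ty a) (Sum.inr a) a]
  parallel := by
    intro s hs
    simp only [List.mem_append, List.mem_singleton, List.mem_map] at hs
    rcases hs with ((rfl | ⟨i, _, rfl⟩) | ⟨i, _, rfl⟩) | rfl
    · rw [List.pairwise_map]
      exact hnd.imp fun h => by simp [Op.qubits, Op.bits, h]
    · exact pairwise_gate_colorClass ty hcA hcD LX i
    · exact pairwise_gate_colorClass ty hcA hcD LZ i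
    · rw [List.pairwise_map]
      exact (List.nodup_reverse.2 hnd).imp fun h => by simp [Op.qubits, Op.bits, h]

variable {ty : A → PauliType} {S : A → Finset D} {c : A → D → ℕ} {k : ℕ} {LX LZ : List A}
  (hnd : (LZ ++ LX).Nodup)
  (hcA : ∀ a, ∀ q ∈ S a, ∀ q' ∈ S a, c a q = c a q' → q = q')
  (hcD : ∀ a a' q, q ∈ S a → q ∈ S a' → c a q = c a' q → a = a')

lemma depth_syndromeCircuit :
    (syndromeCircuit ty S c k LX LZ hnd hcA hcD).depth = 2 * k + 2 := by
  simp [Circuit.depth, syndromeCircuit]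
  ring

lemma traceOut_run_syndromeCircuit (hall : ∀ a, a ∈ LZ ++ LX) (hX : ∀ a ∈ LX, ty a = .X)
    (hZ : ∀ a ∈ LZ, ty a = .Z) (hc : ∀ a, ∀ q ∈ S a, c a q < k)
    (ρ : Operator (D ⊕ A)) (s : A → Fin 2) :
    let K := ((LZ ++ LX).map fun a => eigenProj (pauliString (ty a) (S a)) (s a)).prod
    traceOut ((syndromeCircuit ty S c k LX LZ hnd hcA hcD).run ρ s) =
      K * traceOut ρ * K.conjTranspose := by
  intro K
  rw [← traceOut_foldl ty S LX LZ hnd hall hX hZ _ _ (nodup_flatMap_colorClass S c LX k)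
    (nodup_flatMap_colorClass S c LZ k) (mem_flatMap_colorClass hc LX)
    (mem_flatMap_colorClass hc LZ) ρ s, Circuit.run, ← List.foldl_flatten, syndromeCircuit]
  simp only [List.flatten_append, List.flatten_singleton, List.flatMap_def, List.map_flatten,
    List.map_map, Function.comp_def]

lemma adj_syndromeCircuit {u v : D ⊕ A}
    (h : (syndromeCircuit ty S c k LX LZ hnd hcA hcD).connectivityGraph.Adj u v) :
    ∃ a, ∃ q ∈ S a, (u = .inl q ∧ v = .inr a) ∨ (u = .inr a ∧ v = .inl q) := by
  obtain ⟨s, hs, o, ho, ctl, tgt, hne, rfl, huv⟩ := h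
  have main : ∀ L i, Op.cnot ctl tgt hne ∈ (colorClass S c L i).map (gate ty) →
      ∃ a, ∃ q ∈ S a, (u = .inl q ∧ v = .inr a) ∨ (u = .inr a ∧ v = .inl q) := by
    intro L i h
    obtain ⟨e, he, h⟩ := List.mem_map.1 h
    refine ⟨e.1, e.2, (mem_colorClass.1 he).2.1, ?_⟩
    have h' := gate_eq_cnot h
    rw [Sym2.eq_iff] at h'
    grind
  simp only [syndromeCircuit, List.mem_append, List.mem_singleton, List.mem_map] at hs
  rcases hs with ((rfl | ⟨i, _, rfl⟩) | ⟨i, _, rfl⟩) | rfl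
  · simp at ho
  · exact main LX i ho
  · exact main LZ i ho
  · simp at ho

/-- The colour of a pair of qubits. -/
def pairColor (c : A → D → ℕ) : D ⊕ A → D ⊕ A → ℕ
  | .inl q, .inr a => c a q
  | .inr a, .inl q => c a q
  | _, _ => 0

lemma pairColor_comm (c : A → D → ℕ) (u v : D ⊕ A) : pairColor c u v = pairColor c v u := by
  rcases u with u | u <;> rcases v with v | v <;> rfl

theorem exists_planarLayout_syndromeCircuit (hc : ∀ a, ∀ q ∈ S a, c a q < k)
    (pos : D ⊕ A ↪ ℤ × ℤ) :
    ∃ L : PlanarLayout (syndromeCircuit ty S c k LX LZ hnd hcA hcD).connectivityGraph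
      ⌈(k : ℚ) / 2⌉₊, L.pos = pos := by
  set G := (syndromeCircuit ty S c k LX LZ hnd hcA hcD).connectivityGraph with hG
  let col : Sym2 (D ⊕ A) → ℕ := Sym2.lift ⟨pairColor c, pairColor_comm c⟩
  have hlt : ∀ u v, G.Adj u v → pairColor c u v < k := by
    intro u v h
    obtain ⟨a, q, hq, ⟨rfl, rfl⟩ | ⟨rfl, rfl⟩⟩ := adj_syndromeCircuit hnd hcA hcD h <;>
      exact hc a q hq
  have hinj : ∀ v x y, G.Adj v x → G.Adj v y → pairColor c v x = pairColor c v y → x = y := by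
    intro v x y hx hy e
    obtain ⟨a, q, hq, ⟨rfl, rfl⟩ | ⟨rfl, rfl⟩⟩ := adj_syndromeCircuit hnd hcA hcD hx <;>
      obtain ⟨a', q', hq', ⟨h, rfl⟩ | ⟨h, rfl⟩⟩ := adj_syndromeCircuit hnd hcA hcD hy
    · obtain rfl := Sum.inl_injective h
      rw [hcD a a' q hq hq' e]
    · cases h
    · cases h
    · obtain rfl := Sum.inr_injective h
      rw [hcA a q hq q' hq' e]
  -- Colours `2l` and `2l + 1` share layer `l`. Of three edges of one layer at a vertex, two have
  -- equal colour and so coincide.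
  refine exists_planarLayout G (fun e => ⟨col e / 2, ?_⟩) ?_ pos
  · obtain ⟨e, he⟩ := e
    induction e using Sym2.ind with
    | _ u v =>
      have h : pairColor c u v < k := hlt u v he
      rw [Nat.lt_ceil, lt_div_iff₀ (by norm_num)]
      have : pairColor c u v / 2 * 2 < k := by omega
      exact_mod_cast this
  · intro l v x y z hx hy hz h1 h2 h3
    have e1 : pairColor c v x / 2 = l := congrArg Fin.val h1
    have e2 : pairColor c v y / 2 = l := congrArg Fin.val h2
    have e3 : pairColor c v z / 2 = l := congrArg Fin.val h3
    have : pairColor c v x = pairColor c v y ∨ pairColor c v y = pairColor c v z ∨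
        pairColor c v x = pairColor c v z := by omega
    exact this.imp (hinj v x y hx hy) (Or.imp (hinj v y z hy hz) (hinj v x z hx hz))

end Circuit

end CSSLayout

open CSSLayout in
theorem theorem1 {n rX rZ : ℕ} (Q : CSSLayout.CSSCode n rX rZ) (δ : ℕ)
    (hweight : ∀ g, Q.weight g ≤ δ) (hdegree : ∀ q, Q.qubitDegree q ≤ δ) :
    ∃ C : CSSLayout.Circuit (Fin n ⊕ (Fin rX ⊕ Fin rZ)) (Fin rX ⊕ Fin rZ),
      C.Measures Q ∧ C.depth = 2 * δ + 2 ∧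
      ∀ pos : Fin n ⊕ (Fin rX ⊕ Fin rZ) ↪ ℤ × ℤ,
        ∃ L : CSSLayout.PlanarLayout C.connectivityGraph ⌈(δ : ℚ) / 2⌉₊, L.pos = pos := by
  obtain ⟨c, hc, hcA, hcD⟩ := exists_bipartite_edgeColoring Q.supp δ hweight hdegree
  let ty : Fin rX ⊕ Fin rZ → PauliType := Sum.elim (fun _ => .X) fun _ => .Z
  let LX : List (Fin rX ⊕ Fin rZ) := (List.finRange rX).map Sum.inl
  let LZ : List (Fin rX ⊕ Fin rZ) := (List.finRange rZ).map Sum.inr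
  have hnd : (LZ ++ LX).Nodup := by
    refine List.nodup_append.2 ⟨(List.nodup_finRange _).map Sum.inr_injective,
      (List.nodup_finRange _).map Sum.inl_injective, ?_⟩
    intro a ha b hb
    obtain ⟨i, _, rfl⟩ := List.mem_map.1 ha
    obtain ⟨j, _, rfl⟩ := List.mem_map.1 hb
    simp
  refine ⟨syndromeCircuit ty Q.supp c δ LX LZ hnd hcA hcD, fun ρ s => ?_,
    depth_syndromeCircuit hnd hcA hcD, exists_planarLayout_syndromeCircuit hnd hcA hcD hc⟩
  have hK : ((LZ ++ LX).map fun a => eigenProj (pauliString (ty a) (Q.supp a)) (s a)).prod =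
      Q.syndromeProj s := by
    rw [List.map_append, List.prod_append, List.map_map, List.map_map, CSSCode.syndromeProj]
    -- The circuit yields the Z projectors to the left of the X projectors; commutation of the
    -- generators restores the order in `syndromeProj`.
    refine Commute.list_prod_left _ _ fun x hx => Commute.list_prod_right _ _ fun y hy => ?_
    obtain ⟨j, _, rfl⟩ := List.mem_map.1 hx
    obtain ⟨i, _, rfl⟩ := List.mem_map.1 hy
    exact commute_eigenProj (Q.commute i j).symm _ _
  rw [← hK]
  refine traceOut_run_syndromeCircuit hnd hcA hcD (fun a => ?_) ?_ ?_ hc ρ s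
  · rcases a with a | a <;> simp [LX, LZ]
  · intro a ha
    obtain ⟨i, _, rfl⟩ := List.mem_map.1 ha
    rfl
  · intro a ha
    obtain ⟨i, _, rfl⟩ := List.mem_map.1 ha
    rfl
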